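/- Let $\Phi=(\phi_n)_{n\in\mathbb Z}$ be i.i.d. random variables with values in $[0,1]$ and let $(Z_n)_{n\in\mathbb Z}$ be i.i.d. random variables with values in $\mathbb Z_+=\{0,1,2,\dots\}$. Let $B=(B_{n,k})$ be $\{0,1\}$-valued random variables which, conditionally on $\Phi$, are independent with $P(B_{n,k}=1\mid\Phi)=\phi_n$, and suppose that $(Z_n)_{n\in\mathbb Z}$ is independent of $(\Phi,B)$. The RCINAR(1) process is defined by $$X_n=\sum_{k=1}^{X_{n-1}}B_{n,k}+Z_n,\qquad n\ge 1,$$ with a $\mathbb Z_+$-valued initial value $X_0$ independent of $(\Phi,B,(Z_n)_{n\in\mathbb Z})$ (for example $X_0=0$). Assume (A1) $P(\phi_0=1)<1$; (A2) for some $\alpha>0$ there is a function $h:\mathbb R\to\mathbb R$, regularly varying with index $\alpha$ (that is, $h(t)=t^\alpha L(t)$ for $t>0$, where $L(\lambda t)/L(t)\to1$ as $t\to\infty$ for every $\lambda>0$), such that $\lim_{t\to\infty}h(t)\,P(Z_0>t)=1$. Then there is a $\mathbb Z_+$-valued (in particular almost surely finite) random variable $X_\infty$ such that $X_n$ converges in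 distribution to $X_\infty$ for every law of $X_0$; the law of $X_\infty$ is the unique law of $X_0$ for which $(X_n)_{n\ge0}$ is a stationary sequence; and $$\lim_{t\to\infty}h(t)\,P(X_\infty>t)=\bigl(1-E[\phi_0^\alpha]\bigr)^{-1}\in(0,\infty).$$ -/

import Mathlib

open MeasureTheory ProbabilityTheory Filter Topology

noncomputable section

/-- `f` is regularly varying (at infinity) with index `a`: `f t = t ^ a * L t` for `t > 0`, where
`L (c t) / L t → 1` as `t → ∞` for every `c > 0`. -/
def RegularlyVarying (a : ℝ) (f : ℝ → ℝ) : Prop :=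
  ∃ L : ℝ → ℝ, (∀ t : ℝ, 0 < t → f t = t ^ a * L t) ∧
    ∀ c : ℝ, 0 < c → Tendsto (fun t => L (c * t) / L t) atTop (𝓝 1)

/-- The random coefficients of the model, on a probability space `(Ω, P)`:
`φ n` are i.i.d. with values in `[0, 1]`; `Z n` are i.i.d. non-negative integers; given the whole
sequence `φ`, the variables `B n k` are independent Bernoulli variables with success
probability `φ n`; and the sequence `Z` is independent of the pair `(φ, B)`. -/
structure IsRCINARCoefficients {Ω : Type*} [MeasurableSpace Ω] (P : Measure Ω)
    (φ : ℤ → Ω → ℝ) (Z : ℤ → Ω → ℕ) (B : ℤ → ℕ → Ω → ℕ) : Prop where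
  measurable_phi : ∀ n, Measurable (φ n)
  measurable_Z : ∀ n, Measurable (Z n)
  measurable_B : ∀ n k, Measurable (B n k)
  phi_mem : ∀ n ω, φ n ω ∈ Set.Icc (0 : ℝ) 1
  phi_indep : iIndepFun φ P
  phi_ident : ∀ n, IdentDistrib (φ n) (φ 0) P P
  Z_indep : iIndepFun Z P
  Z_ident : ∀ n, IdentDistrib (Z n) (Z 0) P P
  B_values : ∀ n k ω, B n k ω = 0 ∨ B n k ω = 1
  /-- The finite-dimensional conditional laws of `B` given `φ`: for disjoint finite sets `S`, `T`
  of indices, the conditional probability that `B = 1` on `S` and `B = 0` on `T` is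
  `∏_{(n,k) ∈ S} φ n * ∏_{(n,k) ∈ T} (1 - φ n)`. -/
  B_cond : ∀ S T : Finset (ℤ × ℕ), Disjoint S T →
    P[Set.indicator {ω | (∀ i ∈ S, B i.1 i.2 ω = 1) ∧ ∀ i ∈ T, B i.1 i.2 ω = 0}
        (fun _ => (1 : ℝ)) | MeasurableSpace.comap (fun ω n => φ n ω) MeasurableSpace.pi]
      =ᵐ[P] fun ω => (∏ i ∈ S, φ i.1 ω) * ∏ i ∈ T, (1 - φ i.1 ω)
  indep : IndepFun (fun ω (n : ℤ) => Z n ω)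
    (fun ω => ((fun (n : ℤ) => φ n ω), fun (i : ℤ × ℕ) => B i.1 i.2 ω)) P

/-- The RCINAR(1) recursion `X (n+1) = ∑_{k=1}^{X n} B (n+1) k + Z (n+1)` with `X 0 = x`. -/
def rcinar {Ω : Type*} (Z : ℤ → Ω → ℕ) (B : ℤ → ℕ → Ω → ℕ) (x : ℕ) : ℕ → Ω → ℕ
  | 0, _ => x
  | n + 1, ω => (∑ k ∈ Finset.Icc 1 (rcinar Z B x n ω), B ((n : ℤ) + 1) k ω) + Z ((n : ℤ) + 1) ω

/-- The RCINAR(1) process with a random initial value: on `ℕ × Ω` with the measure `ν × P`, the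
initial value `X 0` is the first coordinate; it has law `ν` and is independent of the
coefficients. The law of the process started at `X 0 = 0` is the case `ν = dirac 0`. -/
def rcinarRandom {Ω : Type*} (Z : ℤ → Ω → ℕ) (B : ℤ → ℕ → Ω → ℕ) (n : ℕ) (p : ℕ × Ω) : ℕ :=
  rcinar Z B p.1 n p.2

/-- `ν` is a stationary law: started from `ν`, the sequences `(X n)_{n ≥ 0}` and
`(X (n+1))_{n ≥ 0}` have the same law. -/
def IsStationaryLaw {Ω : Type*} [MeasurableSpace Ω] (P : Measure Ω)
    (Z : ℤ → Ω → ℕ) (B : ℤ → ℕ → Ω → ℕ) (ν : Measure ℕ) : Prop :=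
  IdentDistrib (fun p (n : ℕ) => rcinarRandom Z B (n + 1) p) (fun p (n : ℕ) => rcinarRandom Z B n p)
    (ν.prod P) (ν.prod P)

end

/-! Integrating out `φ` makes the noise rows (success indicators and immigration at one time)
i.i.d., so the process is a Markov chain governed by a single operator `stepLaw` on laws on `ℕ`.
This operator preserves the stochastic order, because one noise row moves ordered states to ordered
states. It also forgets its starting point: two copies driven by the same noise, started at `y ≤ x`,
have mean distance `(x - y) (E φ)^n` at time `n`, and `E φ < 1` by (A1) (`abs_sub_le`).

The tail estimate is one-step. Let `F` be the tail of `Z 0` and `ρ = E φ^α < 1`. If `ν` has tail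
asymptotic to `c F`, then `stepLaw ν` has tail asymptotic to `(c ρ + 1) F` (`tendsto_stepLaw_tail`).
Indeed the thinning of a large `x` is close to `φ x` by a conditional Chebyshev inequality, the
product `φ x` contributes the factor `ρ` as in Breiman's lemma, and a sum of independent
heavy-tailed terms is large through one of its terms.

Since `c ↦ c ρ + 1` moves large `c` down, the law `κ` of the immigration conditioned to exceed a
high level satisfies `stepLaw κ ≤ κ` (`exists_stochLE_stepLaw`). The iterates from `0` then increase
and stay below `κ`, so no mass escapes and they converge to a law `π`, even when `Z` has infinite
mean; by the coupling all other iterates converge to `π` too.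

Finally `π` lies between the increasing iterates from `0` and the decreasing iterates from `κ`.
After `n` steps their tail constants are `(1 - ρ)⁻¹ + ρ^n (c - (1 - ρ)⁻¹)`, with `c = 0` below and
the constant of `κ` above. Letting `t → ∞` first and `n → ∞` afterwards squeezes the tail of `π`,
with no uniformity in `n` required. -/

/-! ### Independence and common law of the noise rows. -/

/-- The noise driving one step of the process: the success indicators and the immigration. -/
def noiseRow {Ω : Type*} (Z : ℤ → Ω → ℕ) (B : ℤ → ℕ → Ω → ℕ) (n : ℤ) (ω : Ω) : (ℕ → Bool) × ℕ :=
  (fun k => decide (B n k ω = 1), Z n ω)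

/-- Sets of noise rows on which finitely many prescribed indicators are successes. -/
def rowCylinders : Set (Set ((ℕ → Bool) × ℕ)) :=
  {A | ∃ (S : Finset ℕ) (s : Set ℕ), A = {b | ∀ k ∈ S, b k = true} ×ˢ s}

lemma measurableSet_forall_true (S : Finset ℕ) :
    MeasurableSet {b : ℕ → Bool | ∀ k ∈ S, b k = true} := by
  have : {b : ℕ → Bool | ∀ k ∈ S, b k = true} = ⋂ k ∈ S, (fun b => b k) ⁻¹' {true} := by
    ext; simp
  rw [this]
  exact Finset.measurableSet_biInter S fun k _ =>
    measurable_pi_apply k (MeasurableSet.singleton true)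

lemma isPiSystem_rowCylinders : IsPiSystem rowCylinders := by
  classical
  rintro _ ⟨S, s, rfl⟩ _ ⟨S', s', rfl⟩ -
  refine ⟨S ∪ S', s ∩ s', ?_⟩
  rw [Set.prod_inter_prod]
  congr 1
  ext b
  simp only [Set.mem_inter_iff, Set.mem_ofPred_eq, Finset.mem_union]
  constructor
  · rintro ⟨h1, h2⟩ k (hk | hk)
    exacts [h1 k hk, h2 k hk]
  · intro h
    exact ⟨fun k hk => h k (Or.inl hk), fun k hk => h k (Or.inr hk)⟩

/-- A Boolean coordinate is measurable as soon as its preimage of `true` is, so success patterns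
alone generate. Hence laws of rows are determined by mixed moments of the indicators, which are
moments of `φ`. -/
lemma generateFrom_rowCylinders :
    (inferInstance : MeasurableSpace ((ℕ → Bool) × ℕ)) =
      MeasurableSpace.generateFrom rowCylinders := by
  apply le_antisymm
  · refine sup_le ?_ ?_
    · rw [MeasurableSpace.comap_le_iff_le_map]
      refine iSup_le fun k => ?_
      rw [MeasurableSpace.comap_le_iff_le_map]
      have : @Measurable _ _ (MeasurableSpace.generateFrom rowCylinders) _
          (fun p : (ℕ → Bool) × ℕ => p.1 k) := by
        let := MeasurableSpace.generateFrom rowCylinders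
        apply measurable_to_bool
        apply MeasurableSpace.measurableSet_generateFrom
        refine ⟨{k}, Set.univ, ?_⟩
        ext p; simp
      exact fun s hs => this hs
    · rintro _ ⟨s, -, rfl⟩
      apply MeasurableSpace.measurableSet_generateFrom
      refine ⟨∅, s, ?_⟩
      ext p; simp
  · apply MeasurableSpace.generateFrom_le
    rintro _ ⟨S, s, rfl⟩
    exact (measurableSet_forall_true S).prod (MeasurableSet.of_discrete)

lemma integral_mul_eq_of_condExp {Ω : Type*} {m mΩ : MeasurableSpace Ω} {P : Measure Ω}
    [IsFiniteMeasure P] (hm : m ≤ mΩ) {f g k : Ω → ℝ} (hf : StronglyMeasurable[m] f)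
    (hg : Integrable g P) (C : ℝ) (hC : ∀ ω, |f ω| ≤ C) (hk : P[g | m] =ᵐ[P] k) :
    ∫ ω, f ω * g ω ∂P = ∫ ω, f ω * k ω ∂P := by
  have h1 := condExp_stronglyMeasurable_mul_of_bound hm hf hg C (Eventually.of_forall hC)
  have h3 := integral_condExp (μ := P) hm (f := f * g)
  change ∫ ω, (f * g) ω ∂P = _
  rw [← h3]
  refine integral_congr_ae ?_
  filter_upwards [h1, hk] with ω e1 e2
  rw [e1, Pi.mul_apply, e2]

section

variable {Ω : Type*} [MeasurableSpace Ω] {P : Measure Ω}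
  {φ : ℤ → Ω → ℝ} {Z : ℤ → Ω → ℕ} {B : ℤ → ℕ → Ω → ℕ}

lemma IsRCINARCoefficients.measurable_noiseRow (h : IsRCINARCoefficients P φ Z B) (n : ℤ) :
    Measurable (noiseRow Z B n) := by
  refine Measurable.prodMk (measurable_pi_lambda _ fun k => ?_) (h.measurable_Z n)
  exact (measurable_from_top (f := fun j : ℕ => decide (j = 1))).comp (h.measurable_B n k)

lemma IsRCINARCoefficients.measurableSet_forall_eq_one (h : IsRCINARCoefficients P φ Z B)
    (S : Finset (ℤ × ℕ)) : MeasurableSet {ω | ∀ i ∈ S, B i.1 i.2 ω = 1} := by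
  have : {ω | ∀ i ∈ S, B i.1 i.2 ω = 1} = ⋂ i ∈ S, (B i.1 i.2) ⁻¹' {1} := by ext; simp
  rw [this]
  exact Finset.measurableSet_biInter S fun i _ =>
    h.measurable_B i.1 i.2 (MeasurableSet.singleton 1)

variable [IsProbabilityMeasure P]

/-- Mixed moments of the success indicators, weighted by a bounded function of `φ`. -/
lemma IsRCINARCoefficients.integral_indicator_mul (h : IsRCINARCoefficients P φ Z B)
    (S : Finset (ℤ × ℕ)) (ψ : (ℤ → ℝ) → ℝ) (hψ : Measurable ψ) (C : ℝ) (hC : ∀ x, |ψ x| ≤ C) :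
    ∫ ω, ψ (fun n => φ n ω) * Set.indicator {ω | ∀ i ∈ S, B i.1 i.2 ω = 1} (fun _ => (1 : ℝ)) ω ∂P
      = ∫ ω, ψ (fun n => φ n ω) * ∏ i ∈ S, φ i.1 ω ∂P := by
  have h2 := h.B_cond S ∅ (Finset.disjoint_empty_right S)
  simp only [Finset.notMem_empty, false_implies, implies_true, and_true, Finset.prod_empty,
    mul_one] at h2
  exact integral_mul_eq_of_condExp (measurable_pi_lambda _ fun n => h.measurable_phi n).comap_le
    (hψ.comp (comap_measurable _)).stronglyMeasurable
    ((integrable_const 1).indicator (h.measurableSet_forall_eq_one S)) C (fun ω => hC _) h2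

lemma IsRCINARCoefficients.measureReal_forall_eq_one (h : IsRCINARCoefficients P φ Z B)
    (S : Finset (ℤ × ℕ)) :
    P.real {ω | ∀ i ∈ S, B i.1 i.2 ω = 1} = ∫ ω, ∏ i ∈ S, φ i.1 ω ∂P := by
  have := h.integral_indicator_mul S (fun _ => 1) measurable_const 1 (by simp)
  simp only [one_mul] at this
  rw [← this, integral_indicator_const _ (h.measurableSet_forall_eq_one S)]
  simp

/-- The probability of a joint success pattern factorizes over the rows. -/
lemma IsRCINARCoefficients.measureReal_sigma (h : IsRCINARCoefficients P φ Z B)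
    (F : Finset ℤ) (S : ℤ → Finset ℕ) :
    P.real {ω | ∀ n ∈ F, ∀ k ∈ S n, B n k ω = 1}
      = ∏ n ∈ F, ∫ ω, φ 0 ω ^ (S n).card ∂P := by
  classical
  have e : {ω | ∀ n ∈ F, ∀ k ∈ S n, B n k ω = 1} =
      {ω | ∀ i ∈ F.biUnion (fun n => (S n).image (Prod.mk n)), B i.1 i.2 ω = 1} := by
    ext ω
    simp only [Set.mem_ofPred_eq, Finset.mem_biUnion, Finset.mem_image]
    constructor
    · rintro H _ ⟨n, hn, k, hk, rfl⟩
      exact H n hn k hk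
    · intro H n hn k hk
      exact H (n, k) ⟨n, hn, k, hk, rfl⟩
  rw [e, h.measureReal_forall_eq_one]
  have e2 : ∀ ω, ∏ i ∈ F.biUnion (fun n => (S n).image (Prod.mk n)), φ i.1 ω =
      ∏ n : F, φ n ω ^ (S n).card := by
    intro ω
    rw [Finset.prod_biUnion, Finset.prod_coe_sort F (fun n => φ n ω ^ (S n).card)]
    · refine Finset.prod_congr rfl fun n _ => ?_
      rw [Finset.prod_image (by simp)]
      simp
    · intro a _ b _ hab
      simp only [Function.onFun, Finset.disjoint_left, Finset.mem_image]
      rintro _ ⟨k, _, rfl⟩ ⟨k', _, h'⟩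
      exact hab (by simpa using (congrArg Prod.fst h').symm)
  simp only [e2]
  rw [iIndepFun.integral_fun_prod_comp (X := fun n : F => φ n)
    (f := fun n x => x ^ (S n).card) (h.phi_indep.precomp Subtype.val_injective)
    (fun n => (h.measurable_phi n).aemeasurable)
    (fun n => (measurable_id.pow_const _).aestronglyMeasurable)]
  rw [← Finset.prod_coe_sort F]
  refine Finset.prod_congr rfl fun n _ => ?_
  exact ((h.phi_ident n).comp (measurable_id.pow_const (S n).card)).integral_eq

/-- Independence splits off the immigration; the success pattern then contributes moments of the `φ
n`, which factorize because the `φ n` are independent. This product form yields both independence of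
the rows and equality of their laws. -/
lemma IsRCINARCoefficients.measureReal_rows (h : IsRCINARCoefficients P φ Z B)
    (F : Finset ℤ) (S : ℤ → Finset ℕ) (s : ℤ → Set ℕ) :
    P.real (⋂ n ∈ F, noiseRow Z B n ⁻¹' ({b | ∀ k ∈ S n, b k = true} ×ˢ s n))
      = ∏ n ∈ F, (P.real {ω | Z 0 ω ∈ s n} * ∫ ω, φ 0 ω ^ (S n).card ∂P) := by
  have e : (⋂ n ∈ F, noiseRow Z B n ⁻¹' ({b | ∀ k ∈ S n, b k = true} ×ˢ s n)) =
      (fun ω (n : ℤ) => Z n ω) ⁻¹' {z | ∀ n ∈ F, z n ∈ s n} ∩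
      (fun ω => ((fun (n : ℤ) => φ n ω), fun (i : ℤ × ℕ) => B i.1 i.2 ω)) ⁻¹'
        (Set.univ ×ˢ {b | ∀ n ∈ F, ∀ k ∈ S n, b (n, k) = 1}) := by
    ext ω
    simp only [noiseRow, Set.mem_iInter, Set.mem_preimage, Set.mem_prod, Set.mem_ofPred_eq,
      decide_eq_true_eq, Set.mem_inter_iff, Set.mem_univ, true_and]
    exact ⟨fun H => ⟨fun n hn => (H n hn).2, fun n hn => (H n hn).1⟩,
      fun H n hn => ⟨H.2 n hn, H.1 n hn⟩⟩
  have m1 : MeasurableSet {z : ℤ → ℕ | ∀ n ∈ F, z n ∈ s n} := by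
    have : {z : ℤ → ℕ | ∀ n ∈ F, z n ∈ s n} = ⋂ n ∈ F, (fun z => z n) ⁻¹' s n := by ext; simp
    rw [this]
    exact Finset.measurableSet_biInter F fun n _ => measurable_pi_apply n MeasurableSet.of_discrete
  have m2 : MeasurableSet {b : ℤ × ℕ → ℕ | ∀ n ∈ F, ∀ k ∈ S n, b (n, k) = 1} := by
    have : {b : ℤ × ℕ → ℕ | ∀ n ∈ F, ∀ k ∈ S n, b (n, k) = 1} =
        ⋂ n ∈ F, ⋂ k ∈ S n, (fun b => b (n, k)) ⁻¹' {1} := by ext; simp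
    rw [this]
    exact Finset.measurableSet_biInter F fun n _ => Finset.measurableSet_biInter _ fun k _ =>
      measurable_pi_apply (n, k) (MeasurableSet.singleton 1)
  have hI := (indepFun_iff_measure_inter_preimage_eq_mul.1 h.indep) _ _ m1
    (MeasurableSet.univ.prod m2)
  have hZ : P.real {ω | ∀ n ∈ F, Z n ω ∈ s n} = ∏ n ∈ F, P.real {ω | Z 0 ω ∈ s n} := by
    have := (iIndepFun_iff_measure_inter_preimage_eq_mul.1 h.Z_indep) F (sets := s)
      (fun _ _ => MeasurableSet.of_discrete)
    have e : {ω | ∀ n ∈ F, Z n ω ∈ s n} = ⋂ n ∈ F, Z n ⁻¹' s n := by ext; simp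
    rw [e, measureReal_def, this, ENNReal.toReal_prod]
    refine Finset.prod_congr rfl fun n _ => ?_
    rw [(h.Z_ident n).measure_preimage_eq MeasurableSet.of_discrete]
    rfl
  rw [e, measureReal_def, hI, ENNReal.toReal_mul, Finset.prod_mul_distrib, ← hZ,
    ← h.measureReal_sigma F S]
  simp [measureReal_def, Set.preimage]

lemma IsRCINARCoefficients.measureReal_row (h : IsRCINARCoefficients P φ Z B)
    (n : ℤ) (S : Finset ℕ) (s : Set ℕ) :
    P.real (noiseRow Z B n ⁻¹' ({b | ∀ k ∈ S, b k = true} ×ˢ s))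
      = P.real {ω | Z 0 ω ∈ s} * ∫ ω, φ 0 ω ^ S.card ∂P := by
  simpa using h.measureReal_rows {n} (fun _ => S) (fun _ => s)

/-- The noise rows are independent. -/
lemma IsRCINARCoefficients.iIndepFun_noiseRow (h : IsRCINARCoefficients P φ Z B) :
    iIndepFun (noiseRow Z B) P := by
  rw [iIndepFun_iff_iIndep]
  refine iIndepSets.iIndep (fun n => (h.measurable_noiseRow n).comap_le)
    (fun n => {s | ∃ t ∈ rowCylinders, noiseRow Z B n ⁻¹' t = s})
    (fun n => isPiSystem_rowCylinders.comap _) (fun n => ?_) ?_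
  · rw [show (Prod.instMeasurableSpace : MeasurableSpace ((ℕ → Bool) × ℕ)) = _ from
      generateFrom_rowCylinders, MeasurableSpace.comap_generateFrom]
    rfl
  · rw [iIndepSets_iff]
    intro F f hf
    choose! t ht hft using hf
    choose! S s hS using ht
    have e : ∀ n ∈ F, f n = noiseRow Z B n ⁻¹' ({b | ∀ k ∈ S n, b k = true} ×ˢ s n) :=
      fun n hn => by rw [← hft n hn, ← hS n hn]
    rw [Set.iInter₂_congr e, Finset.prod_congr rfl fun n hn => by rw [e n hn]]
    rw [← ENNReal.toReal_eq_toReal_iff' (measure_ne_top _ _)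
      (ENNReal.prod_ne_top fun n _ => measure_ne_top _ _), ENNReal.toReal_prod]
    simp only [← measureReal_def, h.measureReal_row]
    exact h.measureReal_rows F S s

/-- The noise rows are identically distributed. -/
lemma IsRCINARCoefficients.map_noiseRow (h : IsRCINARCoefficients P φ Z B) (n m : ℤ) :
    P.map (noiseRow Z B n) = P.map (noiseRow Z B m) := by
  have hn := h.measurable_noiseRow n
  have hm := h.measurable_noiseRow m
  have := Measure.isProbabilityMeasure_map (μ := P) hn.aemeasurable
  have := Measure.isProbabilityMeasure_map (μ := P) hm.aemeasurable
  refine ext_of_generate_finite rowCylinders generateFrom_rowCylinders isPiSystem_rowCylinders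
    ?_ (by simp)
  rintro _ ⟨S, s, rfl⟩
  have ms : MeasurableSet ({b : ℕ → Bool | ∀ k ∈ S, b k = true} ×ˢ s) :=
    (measurableSet_forall_true S).prod MeasurableSet.of_discrete
  rw [Measure.map_apply hn ms, Measure.map_apply hm ms,
    ← ENNReal.toReal_eq_toReal_iff' (measure_ne_top _ _) (measure_ne_top _ _)]
  simp only [← measureReal_def, h.measureReal_row]

end

/-! ### Markov property. -/

/-- One step of the process as a function of the state and the noise row. -/
def stepMap (x : ℕ) (w : (ℕ → Bool) × ℕ) : ℕ := (∑ k ∈ Finset.Icc 1 x, (w.1 k).toNat) + w.2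

/-- The path of the process as a function of the initial state and the noise. -/
def pathMap (x : ℕ) (w : ℕ → (ℕ → Bool) × ℕ) : ℕ → ℕ
  | 0 => x
  | n + 1 => stepMap (pathMap x w n) (w n)

lemma pathMap_succ_eq (x : ℕ) (w : ℕ → (ℕ → Bool) × ℕ) (n : ℕ) :
    pathMap x w (n + 1) = pathMap (stepMap x (w 0)) (fun m => w (m + 1)) n := by
  induction n with
  | zero => rfl
  | succ n ih => rw [pathMap, ih]; rfl

lemma measurable_stepMap : Measurable (fun p : ℕ × ((ℕ → Bool) × ℕ) => stepMap p.1 p.2) := by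
  refine measurable_from_prod_countable_right fun x => ?_
  simp only [stepMap]
  have h (k : ℕ) : Measurable (fun w : (ℕ → Bool) × ℕ => (w.1 k).toNat) :=
    (measurable_from_top (f := Bool.toNat)).comp ((measurable_pi_apply k).comp measurable_fst)
  exact (Finset.measurable_sum _ fun k _ => h k).add measurable_snd

lemma measurable_pathMap :
    Measurable (fun p : ℕ × (ℕ → (ℕ → Bool) × ℕ) => pathMap p.1 p.2) := by
  refine measurable_pi_lambda _ fun n => ?_
  induction n with
  | zero => exact measurable_fst
  | succ n ih =>
    exact measurable_stepMap.comp (ih.prodMk ((measurable_pi_apply n).comp measurable_snd))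

/-- The law of the state after one step, started from `ν`. -/
noncomputable def stepLaw {Ω : Type*} [MeasurableSpace Ω] (P : Measure Ω)
    (Z : ℤ → Ω → ℕ) (B : ℤ → ℕ → Ω → ℕ) (ν : Measure ℕ) : Measure ℕ :=
  (ν.prod P).map (rcinarRandom Z B 1)

section

variable {Ω : Type*} [MeasurableSpace Ω] {P : Measure Ω}
  {φ : ℤ → Ω → ℝ} {Z : ℤ → Ω → ℕ} {B : ℤ → ℕ → Ω → ℕ}

lemma IsRCINARCoefficients.toNat_decide (h : IsRCINARCoefficients P φ Z B) (n : ℤ) (k : ℕ)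
    (ω : Ω) : (decide (B n k ω = 1)).toNat = B n k ω := by
  rcases h.B_values n k ω with e | e <;> simp [e]

lemma IsRCINARCoefficients.rcinar_eq_pathMap (h : IsRCINARCoefficients P φ Z B)
    (x n : ℕ) (ω : Ω) :
    rcinar Z B x n ω = pathMap x (fun m => noiseRow Z B ((m : ℤ) + 1) ω) n := by
  induction n with
  | zero => rfl
  | succ n ih => simp only [rcinar, pathMap, stepMap, noiseRow, ih, h.toNat_decide]

lemma IsRCINARCoefficients.measurable_rcinarRandom (h : IsRCINARCoefficients P φ Z B) (n : ℕ) :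
    Measurable (rcinarRandom Z B n) := by
  have : rcinarRandom Z B n = fun p : ℕ × Ω =>
      pathMap p.1 (fun m => noiseRow Z B ((m : ℤ) + 1) p.2) n := by
    ext p; exact h.rcinar_eq_pathMap _ _ _
  rw [this]
  exact (measurable_pi_apply n).comp (measurable_pathMap.comp (measurable_fst.prodMk
    (measurable_pi_lambda _ fun m => (h.measurable_noiseRow _).comp measurable_snd)))

variable [IsProbabilityMeasure P]

lemma IsRCINARCoefficients.indepFun_noise (h : IsRCINARCoefficients P φ Z B) :
    IndepFun (noiseRow Z B 1) (fun ω (m : ℕ) => noiseRow Z B ((m : ℤ) + 2) ω) P := by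
  have hi := (iIndepFun_iff_iIndep _ _ _).1 h.iIndepFun_noiseRow
  have := indep_iSup_of_disjoint (fun n => (h.measurable_noiseRow n).comap_le) hi
    (S := {1}) (T := {n | 2 ≤ n}) (by simp)
  refine indep_of_indep_of_le_left (indep_of_indep_of_le_right this ?_) (by simp)
  rw [← measurable_iff_comap_le]
  refine @measurable_pi_lambda _ _ _ (_) _ _ fun m => ?_
  refine Measurable.mono (comap_measurable (noiseRow Z B ((m : ℤ) + 2))) ?_ le_rfl
  exact le_iSup₂_of_le (f := fun (n : ℤ) (_ : n ∈ {n : ℤ | 2 ≤ n}) =>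
    MeasurableSpace.comap (noiseRow Z B n) inferInstance) ((m : ℤ) + 2) (by simp) le_rfl

/-- Either sequence consists of i.i.d. rows, so both laws are the infinite product of the common row
law. -/
lemma IsRCINARCoefficients.map_noise_shift (h : IsRCINARCoefficients P φ Z B) :
    P.map (fun ω (m : ℕ) => noiseRow Z B ((m : ℤ) + 2) ω) =
      P.map (fun ω (m : ℕ) => noiseRow Z B ((m : ℤ) + 1) ω) := by
  have key (c : ℤ) : P.map (fun ω (m : ℕ) => noiseRow Z B ((m : ℤ) + c) ω) =
      Measure.infinitePi (fun _ : ℕ => P.map (noiseRow Z B 0)) := by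
    have hinj : Function.Injective (fun m : ℕ => (m : ℤ) + c) := fun a b hab => by simpa using hab
    rw [(h.iIndepFun_noiseRow.precomp hinj).map_fun_eq_infinitePi_map
      (fun m => h.measurable_noiseRow _)]
    congr 1
    ext1 m
    exact h.map_noiseRow _ _
  rw [key, key]

/-- The process observed from time one on is the process started from the law after one step. -/
theorem IsRCINARCoefficients.map_path_succ (h : IsRCINARCoefficients P φ Z B)
    (ν : Measure ℕ) [IsProbabilityMeasure ν] :
    (ν.prod P).map (fun p (n : ℕ) => rcinarRandom Z B (n + 1) p) =
      ((stepLaw P Z B ν).prod P).map (fun p (n : ℕ) => rcinarRandom Z B n p) := by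
  set W : Ω → ℕ → (ℕ → Bool) × ℕ := fun ω m => noiseRow Z B ((m : ℤ) + 1) ω with hW
  set W' : Ω → ℕ → (ℕ → Bool) × ℕ := fun ω m => noiseRow Z B ((m : ℤ) + 2) ω with hW'
  have mW : Measurable W := measurable_pi_lambda _ fun m => h.measurable_noiseRow _
  have mW' : Measurable W' := measurable_pi_lambda _ fun m => h.measurable_noiseRow _
  have m1 := h.measurable_noiseRow 1
  have p1 := Measure.isProbabilityMeasure_map (μ := P) m1.aemeasurable
  have pW := Measure.isProbabilityMeasure_map (μ := P) mW.aemeasurable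
  have hT : stepLaw P Z B ν = (ν.prod (P.map (noiseRow Z B 1))).map (fun p => stepMap p.1 p.2) := by
    have e : rcinarRandom Z B 1 = (fun p => stepMap p.1 p.2) ∘ Prod.map id (noiseRow Z B 1) := by
      ext p
      exact h.rcinar_eq_pathMap _ _ _
    rw [stepLaw, e, ← Measure.map_map measurable_stepMap (measurable_id.prodMap m1),
      ← Measure.map_prod_map _ _ measurable_id m1, Measure.map_id]
  have hR (μ : Measure ℕ) [IsProbabilityMeasure μ] :
      (μ.prod P).map (fun p (n : ℕ) => rcinarRandom Z B n p) =
        (μ.prod (P.map W)).map (fun p => pathMap p.1 p.2) := by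
    have e : (fun (p : ℕ × Ω) (n : ℕ) => rcinarRandom Z B n p) =
        (fun p => pathMap p.1 p.2) ∘ Prod.map id W := by
      ext p n
      exact h.rcinar_eq_pathMap _ _ _
    rw [e, ← Measure.map_map measurable_pathMap (measurable_id.prodMap mW),
      ← Measure.map_prod_map _ _ measurable_id mW, Measure.map_id]
  have : IsProbabilityMeasure (stepLaw P Z B ν) :=
    Measure.isProbabilityMeasure_map (h.measurable_rcinarRandom 1).aemeasurable
  set G : ℕ × (((ℕ → Bool) × ℕ) × (ℕ → (ℕ → Bool) × ℕ)) → ℕ → ℕ :=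
    fun p => pathMap (stepMap p.1 p.2.1) p.2.2 with hG
  have mG : Measurable G := measurable_pathMap.comp
    ((measurable_stepMap.comp (measurable_fst.prodMk (measurable_fst.comp measurable_snd))).prodMk
      (measurable_snd.comp measurable_snd))
  have e : (fun (p : ℕ × Ω) (n : ℕ) => rcinarRandom Z B (n + 1) p) =
      G ∘ Prod.map id (fun ω => (noiseRow Z B 1 ω, W' ω)) := by
    ext p n
    simp only [rcinarRandom, h.rcinar_eq_pathMap, pathMap_succ_eq, hG, hW', Function.comp,
      Prod.map, id]
    congr 1
  -- The first row is independent of the later ones, so the joint law is a product; the shifted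
  -- future is then replaced by a fresh copy of the noise, and the first row is absorbed into
  -- `stepLaw`.
  rw [e, ← Measure.map_map mG (measurable_id.prodMap (m1.prodMk mW')),
    ← Measure.map_prod_map _ _ measurable_id (m1.prodMk mW'), Measure.map_id,
    (indepFun_iff_map_prod_eq_prod_map_map m1.aemeasurable mW'.aemeasurable).1 h.indepFun_noise,
    hW', h.map_noise_shift, hR, hT, ← Measure.prodAssoc_prod,
    Measure.map_map mG MeasurableEquiv.prodAssoc.measurable]
  conv_rhs => rw [← Measure.map_id (μ := P.map W)]
  rw [Measure.map_prod_map _ _ measurable_stepMap measurable_id,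
    Measure.map_map measurable_pathMap (measurable_stepMap.prodMap measurable_id)]
  rfl

end

/-! ### Conditional first and second moments of the thinning. -/

/-- The thinning of `x` by the success indicators at time one. -/
def thinning {Ω : Type*} (B : ℤ → ℕ → Ω → ℕ) (x : ℕ) (ω : Ω) : ℕ :=
  ∑ k ∈ Finset.Icc 1 x, B 1 k ω

section

variable {Ω : Type*} [MeasurableSpace Ω] {P : Measure Ω}
  {φ : ℤ → Ω → ℝ} {Z : ℤ → Ω → ℕ} {B : ℤ → ℕ → Ω → ℕ}

lemma IsRCINARCoefficients.measurable_thinning (h : IsRCINARCoefficients P φ Z B) (x : ℕ) :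
    Measurable (thinning B x) :=
  Finset.measurable_sum _ fun k _ => h.measurable_B 1 k

lemma IsRCINARCoefficients.thinning_le (h : IsRCINARCoefficients P φ Z B) (x : ℕ) (ω : Ω) :
    thinning B x ω ≤ x := by
  calc thinning B x ω ≤ ∑ k ∈ Finset.Icc 1 x, 1 := Finset.sum_le_sum fun k _ => by
        rcases h.B_values 1 k ω with e | e <;> simp [e]
    _ = x := by simp

lemma thinning_mono {Ω : Type*} (B : ℤ → ℕ → Ω → ℕ) (ω : Ω) {x y : ℕ} (hxy : x ≤ y) :
    thinning B x ω ≤ thinning B y ω :=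
  Finset.sum_le_sum_of_subset (Finset.Icc_subset_Icc_right hxy)

lemma IsRCINARCoefficients.measureReal_thinning_inter (h : IsRCINARCoefficients P φ Z B)
    (x : ℕ) (s : ℝ) :
    P.real ({ω | s < (thinning B x ω : ℝ)} ∩ {ω | s < (Z 1 ω : ℝ)}) =
      P.real {ω | s < (thinning B x ω : ℝ)} * P.real {ω | s < (Z 1 ω : ℝ)} := by
  have hi : IndepFun (thinning B x) (Z 1) P := by
    have m2 : Measurable (fun q : (ℤ → ℝ) × (ℤ × ℕ → ℕ) => ∑ k ∈ Finset.Icc 1 x, q.2 (1, k)) :=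
      Finset.measurable_sum _ fun k _ => (measurable_pi_apply (1, k)).comp measurable_snd
    exact (h.indep.comp (measurable_pi_apply 1) m2).symm
  rw [measureReal_def, measureReal_def, measureReal_def, ← ENNReal.toReal_mul]
  congr 1
  exact indepFun_iff_measure_inter_preimage_eq_mul.1 hi {n : ℕ | s < (n : ℝ)} {n : ℕ | s < (n : ℝ)}
    MeasurableSet.of_discrete MeasurableSet.of_discrete

variable [IsProbabilityMeasure P]

lemma IsRCINARCoefficients.integral_mul_B (h : IsRCINARCoefficients P φ Z B) (k : ℕ)
    (ψ : ℝ → ℝ) (hψ : Measurable ψ) (C : ℝ) (hC : ∀ x, |ψ x| ≤ C) :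
    ∫ ω, ψ (φ 1 ω) * (B 1 k ω : ℝ) ∂P = ∫ ω, ψ (φ 1 ω) * φ 1 ω ∂P := by
  have := h.integral_indicator_mul {(1, k)} (fun f => ψ (f 1)) (hψ.comp (measurable_pi_apply 1)) C
    (fun _ => hC _)
  simp only [Finset.prod_singleton] at this
  rw [← this]
  congr 1
  ext ω
  rcases h.B_values 1 k ω with e | e <;> simp [e, Set.indicator]

lemma IsRCINARCoefficients.integral_mul_B_mul_B (h : IsRCINARCoefficients P φ Z B) {k l : ℕ}
    (hkl : k ≠ l) (ψ : ℝ → ℝ) (hψ : Measurable ψ) (C : ℝ) (hC : ∀ x, |ψ x| ≤ C) :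
    ∫ ω, ψ (φ 1 ω) * ((B 1 k ω : ℝ) * (B 1 l ω : ℝ)) ∂P =
      ∫ ω, ψ (φ 1 ω) * (φ 1 ω * φ 1 ω) ∂P := by
  have := h.integral_indicator_mul {(1, k), (1, l)} (fun f => ψ (f 1))
    (hψ.comp (measurable_pi_apply 1)) C (fun _ => hC _)
  rw [← (show _ = ∫ ω, ψ (φ 1 ω) * (φ 1 ω * φ 1 ω) ∂P by
    simpa [Finset.prod_pair, hkl] using this)]
  congr 1
  ext ω
  rcases h.B_values 1 k ω with e | e <;> rcases h.B_values 1 l ω with e' | e' <;>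
    simp [e, e', Set.indicator]

lemma IsRCINARCoefficients.integrable_mul (h : IsRCINARCoefficients P φ Z B)
    (ψ : ℝ → ℝ) (hψ : Measurable ψ) (C : ℝ) (hC : ∀ x, |ψ x| ≤ C)
    (g : Ω → ℝ) (hg : Measurable g) (D : ℝ) (hD : ∀ ω, |g ω| ≤ D) :
    Integrable (fun ω => ψ (φ 1 ω) * g ω) P := by
  refine Integrable.of_bound ((hψ.comp (h.measurable_phi 1)).mul hg).aestronglyMeasurable (C * D)
    (Eventually.of_forall fun ω => ?_)
  rw [Real.norm_eq_abs, abs_mul]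
  exact mul_le_mul (hC _) (hD _) (abs_nonneg _) ((abs_nonneg _).trans (hC 0))

/-- Conditionally on `φ`, the thinning of `x` has mean `x φ` and variance `x φ (1 - φ)`. -/
lemma IsRCINARCoefficients.integral_mul_sq_sub (h : IsRCINARCoefficients P φ Z B) (x : ℕ)
    (ψ : ℝ → ℝ) (hψ : Measurable ψ) (C : ℝ) (hC : ∀ x, |ψ x| ≤ C) :
    ∫ ω, ψ (φ 1 ω) * ((thinning B x ω : ℝ) - x * φ 1 ω) ^ 2 ∂P =
      ∫ ω, ψ (φ 1 ω) * (x * φ 1 ω * (1 - φ 1 ω)) ∂P := by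
  have hb (k : ℕ) (ω : Ω) : (B 1 k ω : ℝ) ^ 2 = B 1 k ω := by
    rcases h.B_values 1 k ω with e | e <;> simp [e]
  have hφ (ω : Ω) : |φ 1 ω| ≤ 1 := by
    rw [abs_of_nonneg (h.phi_mem 1 ω).1]; exact (h.phi_mem 1 ω).2
  have hB1 (k : ℕ) (ω : Ω) : |(B 1 k ω : ℝ)| ≤ 1 := by
    rcases h.B_values 1 k ω with e | e <;> simp [e]
  have mB (k : ℕ) : Measurable (fun ω => (B 1 k ω : ℝ)) :=
    measurable_from_top.comp (h.measurable_B 1 k)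
  have mφ := h.measurable_phi 1
  have key (k l : ℕ) : ∫ ω, ψ (φ 1 ω) * (((B 1 k ω : ℝ) - φ 1 ω) * ((B 1 l ω : ℝ) - φ 1 ω)) ∂P =
      if k = l then ∫ ω, ψ (φ 1 ω) * (φ 1 ω * (1 - φ 1 ω)) ∂P else 0 := by
    -- Moment formulas require test functions bounded on all of `ℝ`; the factor `φ` is therefore
    -- clipped to `[-1, 1]`, which changes nothing on its range.
    have mψφ : Measurable (fun t : ℝ => ψ t * max (-1) (min t 1)) :=
      hψ.mul (measurable_const.max (measurable_id.min measurable_const))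
    have clip (ω : Ω) : max (-1) (min (φ 1 ω) 1) = φ 1 ω := by
      rw [min_eq_left (h.phi_mem 1 ω).2, max_eq_right]; linarith [(h.phi_mem 1 ω).1]
    have bψφ (t : ℝ) : |ψ t * max (-1) (min t 1)| ≤ C * 1 := by
      rw [abs_mul]
      refine mul_le_mul (hC t) (abs_le.2 ⟨le_max_left _ _, ?_⟩) (abs_nonneg _)
        ((abs_nonneg _).trans (hC 0))
      exact max_le (by norm_num) (min_le_right _ _)
    have i1 (k : ℕ) := h.integral_mul_B k _ mψφ (C * 1) bψφ
    simp only [clip] at i1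
    have I (g : Ω → ℝ) (hg : Measurable g) (hD : ∀ ω, |g ω| ≤ 1) :=
      h.integrable_mul ψ hψ C hC g hg 1 hD
    have mul1 {a b : ℝ} (ha : |a| ≤ 1) (hb : |b| ≤ 1) : |a * b| ≤ 1 := by
      rw [abs_mul]; exact mul_le_one₀ ha (abs_nonneg _) hb
    have e : (fun ω => ψ (φ 1 ω) * (((B 1 k ω : ℝ) - φ 1 ω) * ((B 1 l ω : ℝ) - φ 1 ω))) =
        fun ω => (((ψ (φ 1 ω) * ((B 1 k ω : ℝ) * B 1 l ω)) - ψ (φ 1 ω) * (φ 1 ω * B 1 k ω)) -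
          ψ (φ 1 ω) * (φ 1 ω * B 1 l ω)) + ψ (φ 1 ω) * (φ 1 ω * φ 1 ω) := by
      ext ω; ring
    have J1 := I (fun ω => (B 1 k ω : ℝ) * B 1 l ω) ((mB k).mul (mB l))
      fun ω => mul1 (hB1 k ω) (hB1 l ω)
    have J2 (k : ℕ) := I (fun ω => φ 1 ω * B 1 k ω) (mφ.mul (mB k))
      fun ω => mul1 (hφ ω) (hB1 k ω)
    have J3 := I (fun ω => φ 1 ω * φ 1 ω) (mφ.mul mφ) fun ω => mul1 (hφ ω) (hφ ω)
    have J4 := I (fun ω => φ 1 ω) mφ hφ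
    have J5 : Integrable (fun ω => ψ (φ 1 ω) * ((B 1 k ω : ℝ) * B 1 l ω) -
        ψ (φ 1 ω) * (φ 1 ω * B 1 k ω)) P := J1.sub (J2 k)
    have J6 : Integrable (fun ω => ψ (φ 1 ω) * ((B 1 k ω : ℝ) * B 1 l ω) -
        ψ (φ 1 ω) * (φ 1 ω * B 1 k ω) - ψ (φ 1 ω) * (φ 1 ω * B 1 l ω)) P := J5.sub (J2 l)
    rw [e, integral_add J6 J3, integral_sub J5 (J2 l),
      integral_sub J1 (J2 k)]
    have i2 (k : ℕ) : ∫ ω, ψ (φ 1 ω) * (φ 1 ω * B 1 k ω) ∂P =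
        ∫ ω, ψ (φ 1 ω) * (φ 1 ω * φ 1 ω) ∂P := by
      simpa only [mul_assoc] using i1 k
    rw [i2, i2]
    split_ifs with hkl
    · subst hkl
      have : ∫ ω, ψ (φ 1 ω) * ((B 1 k ω : ℝ) * B 1 k ω) ∂P = ∫ ω, ψ (φ 1 ω) * φ 1 ω ∂P := by
        rw [← h.integral_mul_B k ψ hψ C hC]
        simp only [← pow_two, hb]
      rw [this]
      simp only [mul_sub, mul_one]
      rw [integral_sub J4 J3]
      ring
    · rw [h.integral_mul_B_mul_B hkl ψ hψ C hC]
      ring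
  have e (ω : Ω) : ψ (φ 1 ω) * ((thinning B x ω : ℝ) - x * φ 1 ω) ^ 2 =
      ∑ k ∈ Finset.Icc 1 x, ∑ l ∈ Finset.Icc 1 x,
        ψ (φ 1 ω) * (((B 1 k ω : ℝ) - φ 1 ω) * ((B 1 l ω : ℝ) - φ 1 ω)) := by
    have : (thinning B x ω : ℝ) - x * φ 1 ω = ∑ k ∈ Finset.Icc 1 x, ((B 1 k ω : ℝ) - φ 1 ω) := by
      rw [Finset.sum_sub_distrib, thinning]
      simp
    rw [this, pow_two, Finset.sum_mul_sum, Finset.mul_sum]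
    exact Finset.sum_congr rfl fun k _ => Finset.mul_sum _ _ _
  have hI (k l : ℕ) : Integrable
      (fun ω => ψ (φ 1 ω) * (((B 1 k ω : ℝ) - φ 1 ω) * ((B 1 l ω : ℝ) - φ 1 ω))) P := by
    refine h.integrable_mul ψ hψ C hC _ (((mB k).sub mφ).mul ((mB l).sub mφ)) (2 * 2) fun ω => ?_
    rw [abs_mul]
    have (k : ℕ) : |(B 1 k ω : ℝ) - φ 1 ω| ≤ 2 :=
      (abs_sub _ _).trans (by linarith [hB1 k ω, hφ ω])
    exact mul_le_mul (this k) (this l) (abs_nonneg _) (by norm_num)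
  simp only [e]
  rw [integral_finsetSum _ fun k _ => integrable_finsetSum _ fun l _ => hI k l]
  simp_rw [integral_finsetSum _ fun l _ => hI _ l, key]
  simp only [Finset.sum_ite_eq, Finset.sum_ite_mem, Finset.inter_self, Finset.sum_const,
    Nat.card_Icc, add_tsub_cancel_right, nsmul_eq_mul]
  rw [← integral_const_mul]
  congr 1
  ext ω
  ring

end

/-! ### Stochastic order and convergence of laws on the natural numbers. -/

/-- The usual stochastic order for measures on the natural numbers. -/
def StochLE (μ ν : Measure ℕ) : Prop := ∀ m : ℕ, μ.real (Set.Ici m) ≤ ν.real (Set.Ici m)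

lemma StochLE.trans {μ ν κ : Measure ℕ} (h : StochLE μ ν) (h' : StochLE ν κ) : StochLE μ κ :=
  fun m => (h m).trans (h' m)

lemma stochLE_dirac_zero (ν : Measure ℕ) [IsProbabilityMeasure ν] :
    StochLE (Measure.dirac 0) ν := by
  intro m
  rcases Nat.eq_zero_or_pos m with rfl | hm
  · have : Set.Ici (0 : ℕ) = Set.univ := by ext; simp
    simp [this]
  · have : (Measure.dirac (0 : ℕ)).real (Set.Ici m) = 0 := by
      rw [measureReal_def, Measure.dirac_apply' _ MeasurableSet.of_discrete]
      simp [hm.ne']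
    rw [this]
    exact measureReal_nonneg

lemma eq_of_real_Ici_eq {μ ν : Measure ℕ} [IsProbabilityMeasure μ] [IsProbabilityMeasure ν]
    (h : ∀ m : ℕ, μ.real (Set.Ici m) = ν.real (Set.Ici m)) : μ = ν := by
  refine Measure.ext_of_Ici μ ν fun m => ?_
  exact (ENNReal.toReal_eq_toReal_iff' (measure_ne_top _ _) (measure_ne_top _ _)).1 (h m)

/-- An upper set of natural numbers is empty or of the form `Ici m`. -/
lemma isUpperSet_nat_cases {s : Set ℕ} (hs : IsUpperSet s) : s = ∅ ∨ ∃ m, s = Set.Ici m := by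
  classical
  rcases s.eq_empty_or_nonempty with h | h
  · exact Or.inl h
  · exact Or.inr ⟨Nat.find h, Set.ext fun x =>
      ⟨fun hx => Nat.find_min' h hx, fun hx => hs hx (Nat.find_spec h)⟩⟩

lemma integrable_nat_of_mem_Icc (ν : Measure ℕ) [IsProbabilityMeasure ν] {g : ℕ → ℝ} {C : ℝ}
    (h0 : ∀ x, 0 ≤ g x) (hC : ∀ x, g x ≤ C) : Integrable g ν :=
  Integrable.of_bound measurable_from_top.aestronglyMeasurable C
    (Eventually.of_forall fun x => by rw [Real.norm_eq_abs, abs_of_nonneg (h0 x)]; exact hC x)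

lemma integrable_measureReal {Ω : Type*} [MeasurableSpace Ω] {P : Measure Ω}
    [IsProbabilityMeasure P] (ν : Measure ℕ) [IsProbabilityMeasure ν] (A : ℕ → Set Ω) :
    Integrable (fun x => P.real (A x)) ν :=
  integrable_nat_of_mem_Icc ν (fun _ => measureReal_nonneg) (fun _ => measureReal_le_one)

/-- By the layer-cake formula the integral is an integral of measures of superlevel sets; for
monotone `g` these are upper sets, where the order gives the comparison. -/
lemma StochLE.integral_le {μ ν : Measure ℕ} [IsProbabilityMeasure μ] [IsProbabilityMeasure ν]
    (h : StochLE μ ν) {g : ℕ → ℝ} (hg : Monotone g) (h0 : ∀ x, 0 ≤ g x) {C : ℝ}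
    (hC : ∀ x, g x ≤ C) : ∫ x, g x ∂μ ≤ ∫ x, g x ∂ν := by
  have hI (κ : Measure ℕ) [IsProbabilityMeasure κ] : Integrable g κ :=
    integrable_nat_of_mem_Icc κ h0 hC
  rw [integral_eq_lintegral_of_nonneg_ae (Eventually.of_forall h0)
      measurable_from_top.aestronglyMeasurable,
    integral_eq_lintegral_of_nonneg_ae (Eventually.of_forall h0)
      measurable_from_top.aestronglyMeasurable]
  refine ENNReal.toReal_mono (hI ν).lintegral_lt_top.ne ?_
  rw [lintegral_eq_lintegral_meas_lt μ (Eventually.of_forall h0) measurable_from_top.aemeasurable,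
    lintegral_eq_lintegral_meas_lt ν (Eventually.of_forall h0) measurable_from_top.aemeasurable]
  refine lintegral_mono fun t => ?_
  have hu : IsUpperSet {a | t < g a} := fun a b hab ha => lt_of_lt_of_le ha (hg hab)
  rcases isUpperSet_nat_cases hu with e | ⟨m, e⟩
  · simp [e]
  · simp only [e]
    exact (ENNReal.toReal_le_toReal (measure_ne_top _ _) (measure_ne_top _ _)).1 (h m)

/-- A stochastically increasing, stochastically bounded sequence of laws on the natural numbers
converges pointwise. -/
lemma exists_tendsto_singleton_of_stochLE (μ : ℕ → Measure ℕ) [∀ n, IsProbabilityMeasure (μ n)]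
    (hmono : ∀ n, StochLE (μ n) (μ (n + 1))) (κ : Measure ℕ) [IsProbabilityMeasure κ]
    (hκ : ∀ n, StochLE (μ n) κ) :
    ∃ π : Measure ℕ, IsProbabilityMeasure π ∧
      ∀ m : ℕ, Tendsto (fun n => (μ n).real {m}) atTop (𝓝 (π.real {m})) := by
  have hm (m : ℕ) : ∃ l, Tendsto (fun n => (μ n).real (Set.Ici m)) atTop (𝓝 l) :=
    ⟨_, tendsto_atTop_ciSup (monotone_nat_of_le_succ fun n => hmono n m)
      ⟨1, by rintro _ ⟨n, rfl⟩; exact measureReal_le_one⟩⟩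
  choose L hL using hm
  have hsing (ρ : Measure ℕ) [IsProbabilityMeasure ρ] (m : ℕ) :
      ρ.real {m} = ρ.real (Set.Ici m) - ρ.real (Set.Ici (m + 1)) := by
    have : Set.Ici m = {m} ∪ Set.Ici (m + 1) := by ext x; simp; omega
    rw [this, measureReal_union (by simp) MeasurableSet.of_discrete]
    ring
  have hL0 : L 0 = 1 := by
    have : Set.Ici (0 : ℕ) = Set.univ := by ext; simp
    have h := hL 0
    simp only [this, probReal_univ] at h
    exact tendsto_nhds_unique h tendsto_const_nhds
  have hanti (m : ℕ) : 0 ≤ L m - L (m + 1) := by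
    have := le_of_tendsto_of_tendsto' (hL (m + 1)) (hL m)
      fun n => measureReal_mono (Set.Ici_subset_Ici.2 (Nat.le_succ m))
    linarith
  -- Domination by the single law `κ` is tightness: it forces `L → 0`, so the telescoping masses `L
  -- m - L (m + 1)` add up to one.
  have hκ0 : Tendsto (fun m : ℕ => κ.real (Set.Ici m)) atTop (𝓝 0) := by
    have h := tendsto_measure_iInter_atTop (μ := κ) (s := fun m : ℕ => Set.Ici m)
      (fun m => MeasurableSet.of_discrete.nullMeasurableSet)
      (fun a b hab => Set.Ici_subset_Ici.2 hab) ⟨0, measure_ne_top _ _⟩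
    have e : ⋂ m : ℕ, Set.Ici m = ∅ := by
      ext x
      simp only [Set.mem_iInter, Set.mem_Ici, Set.mem_empty_iff_false, iff_false, not_forall]
      exact ⟨x + 1, by omega⟩
    rw [e, measure_empty] at h
    have h' := (ENNReal.tendsto_toReal ENNReal.zero_ne_top).comp h
    rwa [ENNReal.toReal_zero] at h'
  have hLlim : Tendsto L atTop (𝓝 0) :=
    squeeze_zero (fun m => ge_of_tendsto' (hL m) fun n => measureReal_nonneg)
      (fun m => le_of_tendsto' (hL m) fun n => hκ n m) hκ0
  have hsum : HasSum (fun m => L m - L (m + 1)) 1 := by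
    rw [hasSum_iff_tendsto_nat_of_nonneg hanti]
    simp only [Finset.sum_range_sub', hL0]
    simpa using tendsto_const_nhds.sub hLlim
  refine ⟨Measure.sum fun m => ENNReal.ofReal (L m - L (m + 1)) • Measure.dirac m, ⟨?_⟩, ?_⟩
  · rw [Measure.sum_apply _ MeasurableSet.univ]
    simp only [Measure.smul_apply, measure_univ, smul_eq_mul, mul_one]
    rw [← ENNReal.ofReal_tsum_of_nonneg hanti hsum.summable, hsum.tsum_eq, ENNReal.ofReal_one]
  · intro m
    have e : (Measure.sum fun m => ENNReal.ofReal (L m - L (m + 1)) • Measure.dirac m).real {m}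
        = L m - L (m + 1) := by
      rw [measureReal_def, Measure.sum_apply _ (MeasurableSet.singleton m), tsum_eq_single m]
      · simp [hanti m]
      · intro k hk
        simp [hk]
    rw [e]
    simp only [hsing]
    exact (hL m).sub (hL (m + 1))

lemma tendsto_probabilityMeasure_nat {μ : ℕ → ProbabilityMeasure ℕ} {π : ProbabilityMeasure ℕ}
    (h : ∀ m : ℕ, Tendsto (fun n => (μ n : Measure ℕ).real {m}) atTop
      (𝓝 ((π : Measure ℕ).real {m}))) : Tendsto μ atTop (𝓝 π) := by
  refine IsPiSystem.tendsto_probabilityMeasure_of_tendsto_of_mem (S := Set.range fun m : ℕ => {m})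
    ?_ (fun s _ => MeasurableSet.of_discrete) ?_ ?_
  · rintro _ ⟨a, rfl⟩ _ ⟨b, rfl⟩ ⟨x, hx⟩
    simp only [Set.mem_inter_iff, Set.mem_singleton_iff] at hx
    obtain ⟨rfl, rfl⟩ := hx
    exact ⟨x, by simp⟩
  · intro u _ x hx
    exact ⟨{x}, ⟨x, rfl⟩, by simp, by simpa using hx⟩
  · rintro _ ⟨m, rfl⟩
    rw [← NNReal.tendsto_coe]
    exact h m

/-- Convergence of point masses to a probability law is weak convergence, and every subset of a
discrete space is clopen, so has no boundary. -/
lemma tendsto_real_of_tendsto_singleton {μ : ℕ → Measure ℕ} [∀ n, IsProbabilityMeasure (μ n)]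
    {π : Measure ℕ} [IsProbabilityMeasure π]
    (h : ∀ m : ℕ, Tendsto (fun n => (μ n).real {m}) atTop (𝓝 (π.real {m}))) (s : Set ℕ) :
    Tendsto (fun n => (μ n).real s) atTop (𝓝 (π.real s)) := by
  have := ProbabilityMeasure.tendsto_measure_of_isClopen_of_tendsto
    (tendsto_probabilityMeasure_nat (μ := fun n => ⟨μ n, inferInstance⟩)
      (π := ⟨π, inferInstance⟩) h) (isClopen_discrete s)
  rw [← NNReal.tendsto_coe] at this
  exact this

/-! ### Contraction, the limit law and stationarity. -/

section

variable {Ω : Type*} [MeasurableSpace Ω] {P : Measure Ω} [IsProbabilityMeasure P]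
  {φ : ℤ → Ω → ℝ} {Z : ℤ → Ω → ℕ} {B : ℤ → ℕ → Ω → ℕ}

lemma IsRCINARCoefficients.isProbabilityMeasure_stepLaw (h : IsRCINARCoefficients P φ Z B)
    (ν : Measure ℕ) [IsProbabilityMeasure ν] : IsProbabilityMeasure (stepLaw P Z B ν) :=
  Measure.isProbabilityMeasure_map (h.measurable_rcinarRandom 1).aemeasurable

lemma IsRCINARCoefficients.isProbabilityMeasure_iterate (h : IsRCINARCoefficients P φ Z B)
    (n : ℕ) (ν : Measure ℕ) [IsProbabilityMeasure ν] :
    IsProbabilityMeasure ((stepLaw P Z B)^[n] ν) := by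
  induction n with
  | zero => assumption
  | succ n ih =>
    rw [Function.iterate_succ_apply']
    exact h.isProbabilityMeasure_stepLaw _

/-- The law of the state at time `n`. -/
lemma IsRCINARCoefficients.map_rcinarRandom (h : IsRCINARCoefficients P φ Z B)
    (n : ℕ) (ν : Measure ℕ) [IsProbabilityMeasure ν] :
    (ν.prod P).map (rcinarRandom Z B n) = (stepLaw P Z B)^[n] ν := by
  induction n generalizing ν with
  | zero =>
    have : rcinarRandom Z B 0 = (Prod.fst : ℕ × Ω → ℕ) := rfl
    rw [this, ← Measure.fst, Measure.fst_prod]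
    rfl
  | succ n ih =>
    have := h.isProbabilityMeasure_stepLaw ν
    have e := congrArg (Measure.map fun f : ℕ → ℕ => f n) (h.map_path_succ ν)
    rw [Measure.map_map (measurable_pi_apply n)
        (measurable_pi_lambda _ fun n => h.measurable_rcinarRandom _),
      Measure.map_map (measurable_pi_apply n)
        (measurable_pi_lambda _ fun n => h.measurable_rcinarRandom _)] at e
    exact e.trans (ih _)

lemma IsRCINARCoefficients.iterate_real_eq_integral (h : IsRCINARCoefficients P φ Z B)
    (n : ℕ) (ν : Measure ℕ) [IsProbabilityMeasure ν] (s : Set ℕ) :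
    ((stepLaw P Z B)^[n] ν).real s = ∫ x, P.real {ω | rcinar Z B x n ω ∈ s} ∂ν := by
  rw [← h.map_rcinarRandom, map_measureReal_apply (h.measurable_rcinarRandom n)
    MeasurableSet.of_discrete, measureReal_def, Measure.prod_apply
      (h.measurable_rcinarRandom n MeasurableSet.of_discrete)]
  rw [integral_eq_lintegral_of_nonneg_ae (Eventually.of_forall fun x => measureReal_nonneg)
    measurable_from_top.aestronglyMeasurable]
  congr 1
  refine lintegral_congr fun x => ?_
  rw [ofReal_measureReal]
  rfl

lemma rcinar_one {Ω : Type*} (Z : ℤ → Ω → ℕ) (B : ℤ → ℕ → Ω → ℕ) (x : ℕ) (ω : Ω) :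
    rcinar Z B x 1 ω = thinning B x ω + Z 1 ω := by
  simp [rcinar, thinning]

lemma IsRCINARCoefficients.stepLaw_real_eq_integral (h : IsRCINARCoefficients P φ Z B)
    (ν : Measure ℕ) [IsProbabilityMeasure ν] (s : Set ℕ) :
    (stepLaw P Z B ν).real s = ∫ x, P.real {ω | thinning B x ω + Z 1 ω ∈ s} ∂ν := by
  have e := h.iterate_real_eq_integral 1 ν s
  rw [Function.iterate_one] at e
  simpa only [rcinar_one] using e

/-- One step of the process preserves the stochastic order. -/
lemma IsRCINARCoefficients.stochLE_stepLaw (h : IsRCINARCoefficients P φ Z B)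
    {μ ν : Measure ℕ} [IsProbabilityMeasure μ] [IsProbabilityMeasure ν] (hμν : StochLE μ ν) :
    StochLE (stepLaw P Z B μ) (stepLaw P Z B ν) := by
  intro m
  rw [h.stepLaw_real_eq_integral, h.stepLaw_real_eq_integral]
  refine hμν.integral_le (fun x y hxy => measureReal_mono fun ω hω => ?_)
    (fun x => measureReal_nonneg) (C := 1) fun x => measureReal_le_one
  have := thinning_mono B ω hxy
  simp only [Set.mem_Ici, Set.mem_ofPred_eq] at hω ⊢
  omega

lemma IsRCINARCoefficients.stochLE_iterate (h : IsRCINARCoefficients P φ Z B) (n : ℕ)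
    {μ ν : Measure ℕ} [IsProbabilityMeasure μ] [IsProbabilityMeasure ν] (hμν : StochLE μ ν) :
    StochLE ((stepLaw P Z B)^[n] μ) ((stepLaw P Z B)^[n] ν) := by
  induction n with
  | zero => exact hμν
  | succ n ih =>
    have := h.isProbabilityMeasure_iterate n μ
    have := h.isProbabilityMeasure_iterate n ν
    simp only [Function.iterate_succ_apply']
    exact h.stochLE_stepLaw ih

lemma IsRCINARCoefficients.integral_thinning_sub (h : IsRCINARCoefficients P φ Z B) (x y : ℕ) :
    ∫ ω, ((thinning B x ω : ℝ) - thinning B y ω) ∂P =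
      ((x : ℝ) - y) * ∫ ω, φ 0 ω ∂P := by
  have mB (k : ℕ) : Integrable (fun ω => (B 1 k ω : ℝ)) P :=
    Integrable.of_bound (measurable_from_top.comp (h.measurable_B 1 k)).aestronglyMeasurable 1
      (Eventually.of_forall fun ω => by rcases h.B_values 1 k ω with e | e <;> simp [e])
  have hB (k : ℕ) : ∫ ω, (B 1 k ω : ℝ) ∂P = ∫ ω, φ 0 ω ∂P := by
    have := h.integral_mul_B k (fun _ => 1) measurable_const 1 (by simp)
    simp only [one_mul] at this
    rw [this, (h.phi_ident 1).integral_eq]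
  have hx (x : ℕ) : Integrable (fun ω => (thinning B x ω : ℝ)) P ∧
      ∫ ω, (thinning B x ω : ℝ) ∂P = x * ∫ ω, φ 0 ω ∂P := by
    simp only [thinning, Nat.cast_sum]
    refine ⟨integrable_finsetSum _ fun k _ => mB k, ?_⟩
    rw [integral_finsetSum _ fun k _ => mB k]
    simp [hB]
  rw [integral_sub (hx x).1 (hx y).1, (hx x).2, (hx y).2]
  ring

/-- The transition probabilities of the process forget the initial state geometrically fast. -/
lemma IsRCINARCoefficients.abs_sub_le (h : IsRCINARCoefficients P φ Z B) (s : Set ℕ) (n : ℕ)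
    {x y : ℕ} (hyx : y ≤ x) :
    |P.real {ω | rcinar Z B x n ω ∈ s} - P.real {ω | rcinar Z B y n ω ∈ s}| ≤
      ((x : ℝ) - y) * (∫ ω, φ 0 ω ∂P) ^ n := by
  induction n generalizing x y with
  | zero =>
    simp only [rcinar, pow_zero, mul_one]
    rcases hyx.eq_or_lt with rfl | hlt
    · simp
    -- Distinct integers differ by at least one, which bounds any difference of probabilities.
    · have h1 : (1 : ℝ) ≤ x - y := by
        have : (y : ℝ) + 1 ≤ x := by exact_mod_cast hlt
        linarith
      refine le_trans ?_ h1
      rw [abs_le]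
      constructor <;> linarith [measureReal_nonneg (μ := P) (s := {ω | x ∈ s}),
        measureReal_nonneg (μ := P) (s := {ω | y ∈ s}),
        measureReal_le_one (μ := P) (s := {ω | x ∈ s}),
        measureReal_le_one (μ := P) (s := {ω | y ∈ s})]
  | succ n ih =>
    set u : ℕ → ℝ := fun x => P.real {ω | rcinar Z B x n ω ∈ s} with hu
    have hstep (x : ℕ) : P.real {ω | rcinar Z B x (n + 1) ω ∈ s} =
        ∫ ω, u (thinning B x ω + Z 1 ω) ∂P := by
      have e1 := h.iterate_real_eq_integral (n + 1) (Measure.dirac x) s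
      have := h.isProbabilityMeasure_stepLaw (Measure.dirac x)
      rw [integral_dirac, Function.iterate_succ_apply, h.iterate_real_eq_integral, stepLaw,
        integral_map (h.measurable_rcinarRandom 1).aemeasurable
          measurable_from_top.aestronglyMeasurable, Measure.dirac_prod] at e1
      have e2 : ∫ q, u (rcinarRandom Z B 1 q) ∂(P.map (Prod.mk x)) =
          ∫ ω, u (rcinarRandom Z B 1 (x, ω)) ∂P :=
        integral_map measurable_prodMk_left.aemeasurable
          ((measurable_from_top (f := u)).comp (h.measurable_rcinarRandom 1)).aestronglyMeasurable
      simp only [rcinarRandom, rcinar_one] at e1 e2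
      exact e1.symm.trans e2
    have hmeas (x : ℕ) : Measurable (fun ω => thinning B x ω + Z 1 ω) :=
      (h.measurable_thinning x).add (h.measurable_Z 1)
    have hint (x : ℕ) : Integrable (fun ω => u (thinning B x ω + Z 1 ω)) P :=
      Integrable.of_bound ((measurable_from_top (f := u)).comp (hmeas x)).aestronglyMeasurable 1
        (Eventually.of_forall fun ω => by
          rw [Real.norm_eq_abs, abs_of_nonneg measureReal_nonneg]; exact measureReal_le_one)
    have hthin (x : ℕ) : Integrable (fun ω => (thinning B x ω : ℝ)) P :=
      Integrable.of_bound (measurable_from_top.comp (h.measurable_thinning x)).aestronglyMeasurable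
        x (Eventually.of_forall fun ω => by simpa using h.thinning_le x ω)
    rw [hstep, hstep, ← integral_sub (hint x) (hint y)]
    -- Both copies use the same noise row. The thinnings stay ordered, so the induction hypothesis
    -- applies for each `ω`, and the mean gap is multiplied by `E φ`.
    calc |∫ ω, (u (thinning B x ω + Z 1 ω) - u (thinning B y ω + Z 1 ω)) ∂P|
        ≤ ∫ ω, |u (thinning B x ω + Z 1 ω) - u (thinning B y ω + Z 1 ω)| ∂P :=
          abs_integral_le_integral_abs
      _ ≤ ∫ ω, ((thinning B x ω : ℝ) - thinning B y ω) * (∫ ω, φ 0 ω ∂P) ^ n ∂P := by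
          refine integral_mono ((hint x).sub (hint y)).abs
            (((hthin x).sub (hthin y)).mul_const _) fun ω => ?_
          refine (ih (x := thinning B x ω + Z 1 ω) (y := thinning B y ω + Z 1 ω)
            (Nat.add_le_add_right (thinning_mono B ω hyx) _)).trans_eq ?_
          push_cast
          ring
      _ = ((x : ℝ) - y) * (∫ ω, φ 0 ω ∂P) ^ (n + 1) := by
          rw [integral_mul_const, h.integral_thinning_sub]
          ring

/-- The geometric bound is proportional to the initial state, whose mean under `ν` may be infinite.
It is used only pointwise in `x`; the trivial bound `1` supplies domination. -/
lemma IsRCINARCoefficients.tendsto_iterate_sub (h : IsRCINARCoefficients P φ Z B)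
    (hφ : ∫ ω, φ 0 ω ∂P < 1) (ν : Measure ℕ) [IsProbabilityMeasure ν] (s : Set ℕ) :
    Tendsto (fun n => ((stepLaw P Z B)^[n] ν).real s -
      ((stepLaw P Z B)^[n] (Measure.dirac 0)).real s) atTop (𝓝 0) := by
  have hφ0 : 0 ≤ ∫ ω, φ 0 ω ∂P := integral_nonneg fun ω => (h.phi_mem 0 ω).1
  have hint (n : ℕ) : Integrable (fun x => P.real {ω | rcinar Z B x n ω ∈ s}) ν :=
    integrable_measureReal ν _
  have e (n : ℕ) : ((stepLaw P Z B)^[n] ν).real s -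
      ((stepLaw P Z B)^[n] (Measure.dirac 0)).real s =
      ∫ x, (P.real {ω | rcinar Z B x n ω ∈ s} - P.real {ω | rcinar Z B 0 n ω ∈ s}) ∂ν := by
    rw [h.iterate_real_eq_integral, h.iterate_real_eq_integral, integral_dirac,
      integral_sub (hint n) (integrable_const _)]
    simp
  simp only [e]
  have := tendsto_integral_of_dominated_convergence (μ := ν) (F := fun n x =>
      P.real {ω | rcinar Z B x n ω ∈ s} - P.real {ω | rcinar Z B 0 n ω ∈ s})
    (f := fun _ => 0) (fun _ => 1)
    (fun n => measurable_from_top.aestronglyMeasurable) (integrable_const 1)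
    (fun n => Eventually.of_forall fun x => ?_) (Eventually.of_forall fun x => ?_)
  · simpa using this
  · rw [Real.norm_eq_abs, abs_le]
    constructor <;> linarith [measureReal_nonneg (μ := P) (s := {ω | rcinar Z B x n ω ∈ s}),
      measureReal_nonneg (μ := P) (s := {ω | rcinar Z B 0 n ω ∈ s}),
      measureReal_le_one (μ := P) (s := {ω | rcinar Z B x n ω ∈ s}),
      measureReal_le_one (μ := P) (s := {ω | rcinar Z B 0 n ω ∈ s})]
  · refine squeeze_zero_norm (fun n => h.abs_sub_le s n (Nat.zero_le x)) ?_
    simpa using (tendsto_pow_atTop_nhds_zero_of_lt_one hφ0 hφ).const_mul ((x : ℝ) - (0 : ℕ))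

/-- If some law is stochastically decreased by one step of the process, the process has a limit
law, which does not depend on the initial law. -/
lemma IsRCINARCoefficients.exists_limit (h : IsRCINARCoefficients P φ Z B)
    (hφ : ∫ ω, φ 0 ω ∂P < 1) (κ : Measure ℕ) [IsProbabilityMeasure κ]
    (hκ : StochLE (stepLaw P Z B κ) κ) :
    ∃ π : Measure ℕ, IsProbabilityMeasure π ∧ ∀ (ν : Measure ℕ) [IsProbabilityMeasure ν]
      (s : Set ℕ), Tendsto (fun n => ((stepLaw P Z B)^[n] ν).real s) atTop (𝓝 (π.real s)) := by
  have hp := fun n => h.isProbabilityMeasure_iterate n (Measure.dirac 0)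
  have hp' := fun n => h.isProbabilityMeasure_iterate n κ
  have hdec (n : ℕ) : StochLE ((stepLaw P Z B)^[n] κ) κ := by
    induction n with
    | zero => exact fun m => le_rfl
    | succ n ih =>
      rw [Function.iterate_succ_apply']
      exact (h.stochLE_stepLaw ih).trans hκ
  have hinc (n : ℕ) : StochLE ((stepLaw P Z B)^[n] (Measure.dirac 0))
      ((stepLaw P Z B)^[n + 1] (Measure.dirac 0)) := by
    have := h.isProbabilityMeasure_stepLaw (Measure.dirac 0)
    rw [Function.iterate_succ_apply]
    exact h.stochLE_iterate n (stochLE_dirac_zero _)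
  obtain ⟨π, hπ, hlim⟩ := exists_tendsto_singleton_of_stochLE
    (fun n => (stepLaw P Z B)^[n] (Measure.dirac 0)) hinc κ
    (fun n => (h.stochLE_iterate n (stochLE_dirac_zero κ)).trans (hdec n))
  refine ⟨π, hπ, fun ν _ s => ?_⟩
  simpa using (h.tendsto_iterate_sub hφ ν s).add (tendsto_real_of_tendsto_singleton hlim s)

lemma IsRCINARCoefficients.tendstoInDistribution (h : IsRCINARCoefficients P φ Z B)
    {π : Measure ℕ} [IsProbabilityMeasure π] (ν : Measure ℕ) [IsProbabilityMeasure ν]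
    (hlim : ∀ s : Set ℕ, Tendsto (fun n => ((stepLaw P Z B)^[n] ν).real s) atTop
      (𝓝 (π.real s))) :
    TendstoInDistribution (fun n : ℕ => rcinarRandom Z B n) atTop (fun x : ℕ => x)
      (fun _ => ν.prod P) π where
  forall_aemeasurable n := (h.measurable_rcinarRandom n).aemeasurable
  aemeasurable_limit := measurable_id.aemeasurable
  tendsto := by
    refine tendsto_probabilityMeasure_nat fun m => ?_
    simp only [ProbabilityMeasure.coe_mk, h.map_rcinarRandom, Measure.map_id']
    exact hlim {m}

/-- Monotonicity replaces continuity of `stepLaw`. The iterates from `0` lie below `π`, so one more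
step and a limit give `π ≤ stepLaw π`. The iterates from `π` therefore increase, and since they
converge to `π`, also `stepLaw π ≤ π`. -/
lemma IsRCINARCoefficients.stepLaw_limit (h : IsRCINARCoefficients P φ Z B)
    {π : Measure ℕ} [IsProbabilityMeasure π]
    (hlim : ∀ (ν : Measure ℕ) [IsProbabilityMeasure ν] (s : Set ℕ),
      Tendsto (fun n => ((stepLaw P Z B)^[n] ν).real s) atTop (𝓝 (π.real s))) :
    stepLaw P Z B π = π := by
  have hp := h.isProbabilityMeasure_stepLaw π
  have hp0 := h.isProbabilityMeasure_stepLaw (Measure.dirac 0)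
  have hpn := fun n => h.isProbabilityMeasure_iterate n (Measure.dirac 0)
  have hinc (n : ℕ) : StochLE ((stepLaw P Z B)^[n] (Measure.dirac 0)) π := by
    intro m
    refine Monotone.ge_of_tendsto (f := fun n =>
      ((stepLaw P Z B)^[n] (Measure.dirac 0)).real (Set.Ici m)) ?_ (hlim _ _) n
    refine monotone_nat_of_le_succ fun n => ?_
    rw [Function.iterate_succ_apply]
    exact h.stochLE_iterate n (stochLE_dirac_zero _) m
  have hle : StochLE π (stepLaw P Z B π) := by
    intro m
    refine le_of_tendsto ((tendsto_add_atTop_iff_nat 1).2 (hlim (Measure.dirac 0) (Set.Ici m)))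
      (Eventually.of_forall fun n => ?_)
    rw [Function.iterate_succ_apply']
    exact h.stochLE_stepLaw (hinc n) m
  refine (eq_of_real_Ici_eq fun m => le_antisymm (hle m) ?_).symm
  refine Monotone.ge_of_tendsto (f := fun n =>
      ((stepLaw P Z B)^[n] π).real (Set.Ici m)) ?_ (hlim _ _) 1
  refine monotone_nat_of_le_succ fun n => ?_
  rw [Function.iterate_succ_apply]
  exact h.stochLE_iterate n hle m

lemma IsRCINARCoefficients.isStationaryLaw_iff (h : IsRCINARCoefficients P φ Z B)
    {π : Measure ℕ} [IsProbabilityMeasure π]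
    (hlim : ∀ (ν : Measure ℕ) [IsProbabilityMeasure ν] (s : Set ℕ),
      Tendsto (fun n => ((stepLaw P Z B)^[n] ν).real s) atTop (𝓝 (π.real s)))
    (ν : Measure ℕ) [IsProbabilityMeasure ν] : IsStationaryLaw P Z B ν ↔ ν = π := by
  constructor
  · intro hst
    have h1 : stepLaw P Z B ν = ν := by
      have := (hst.comp (measurable_pi_apply 0)).map_eq
      exact (h.map_rcinarRandom 1 ν).symm.trans (this.trans (h.map_rcinarRandom 0 ν))
    have hn (n : ℕ) : (stepLaw P Z B)^[n] ν = ν := Function.iterate_fixed h1 n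
    refine eq_of_real_Ici_eq fun m => ?_
    have := hlim ν (Set.Ici m)
    simp only [hn] at this
    exact tendsto_nhds_unique tendsto_const_nhds this
  · rintro rfl
    refine ⟨(measurable_pi_lambda _ fun n => h.measurable_rcinarRandom _).aemeasurable,
      (measurable_pi_lambda _ fun n => h.measurable_rcinarRandom _).aemeasurable, ?_⟩
    rw [h.map_path_succ, h.stepLaw_limit hlim]

end

/-! ### Regularly varying tails and products. -/

/-- A tail function that is regularly varying with index `-α`. -/
structure IsRegularTail (α : ℝ) (F : ℝ → ℝ) : Prop where
  antitone : Antitone F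
  pos : ∀ t, 0 < F t
  tendsto_zero : Tendsto F atTop (𝓝 0)
  tendsto_ratio : ∀ c : ℝ, 0 < c → Tendsto (fun t => F (c * t) / F t) atTop (𝓝 (c ^ (-α)))

lemma tendsto_tail_zero {Ω : Type*} [MeasurableSpace Ω] (P : Measure Ω) [IsProbabilityMeasure P]
    (Y : Ω → ℕ) (hY : Measurable Y) :
    Tendsto (fun t : ℝ => P.real {ω | t < (Y ω : ℝ)}) atTop (𝓝 0) := by
  have hm (t : ℝ) : MeasurableSet {ω | t < (Y ω : ℝ)} :=
    measurableSet_lt measurable_const (measurable_from_top.comp hY)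
  have h := tendsto_measure_iInter_atTop (μ := P) (s := fun t : ℝ => {ω | t < (Y ω : ℝ)})
    (fun t => (hm t).nullMeasurableSet) (fun a b hab ω hω => lt_of_le_of_lt hab hω)
    ⟨0, measure_ne_top _ _⟩
  have e : ⋂ t : ℝ, {ω | t < (Y ω : ℝ)} = ∅ := by
    ext ω
    simp only [Set.mem_iInter, Set.mem_ofPred_eq, Set.mem_empty_iff_false, iff_false, not_forall]
    exact ⟨Y ω, lt_irrefl _⟩
  rw [e, measure_empty] at h
  have h' := (ENNReal.tendsto_toReal ENNReal.zero_ne_top).comp h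
  rwa [ENNReal.toReal_zero] at h'

lemma RegularlyVarying.isRegularTail {α : ℝ} {h F : ℝ → ℝ} (hreg : RegularlyVarying α h)
    (hF : Antitone F) (hF0 : ∀ t, 0 ≤ F t) (hlim : Tendsto F atTop (𝓝 0))
    (hhF : Tendsto (fun t => h t * F t) atTop (𝓝 1)) : IsRegularTail α F := by
  have hne : ∀ᶠ t in atTop, h t * F t ≠ 0 := hhF.eventually_ne one_ne_zero
  have hpos (t : ℝ) : 0 < F t := by
    -- Positivity at arbitrarily large `s` passes to every `t`, since `F` is antitone.
    obtain ⟨s, hs, hts⟩ := (hne.and (eventually_ge_atTop t)).exists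
    exact lt_of_lt_of_le ((hF0 s).lt_of_ne' (right_ne_zero_of_mul hs)) (hF hts)
  refine ⟨hF, hpos, hlim, fun c hc => ?_⟩
  obtain ⟨L, hL, hLc⟩ := hreg
  have hct : Tendsto (fun t : ℝ => c * t) atTop atTop := tendsto_id.const_mul_atTop hc
  have h1 : Tendsto (fun t => (h (c * t) * F (c * t)) / (h t * F t) *
      (c ^ α * (L (c * t) / L t))⁻¹) atTop (𝓝 (1 / 1 * (c ^ α * 1)⁻¹)) :=
    ((hhF.comp hct).div hhF one_ne_zero).mul
      (((hLc c hc).const_mul _).inv₀ (by positivity))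
  rw [show 1 / 1 * (c ^ α * 1)⁻¹ = c ^ (-α) by rw [Real.rpow_neg hc.le]; ring] at h1
  refine h1.congr' ?_
  filter_upwards [hne, hct.eventually hne, eventually_gt_atTop 0] with t n1 n2 ht
  have a1 := left_ne_zero_of_mul n1
  have a2 := left_ne_zero_of_mul n2
  have a3 := (hpos t).ne'
  rw [hL t ht] at a1
  rw [hL (c * t) (mul_pos hc ht)] at a2
  rw [hL t ht, hL (c * t) (mul_pos hc ht), Real.mul_rpow hc.le ht.le]
  have b1 := left_ne_zero_of_mul a1
  have b2 := right_ne_zero_of_mul a1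
  have b3 := right_ne_zero_of_mul a2
  have b4 : c ^ α ≠ 0 := (Real.rpow_pos_of_pos hc α).ne'
  field_simp

lemma IsRegularTail.tendsto_comp_mul {α : ℝ} {F g : ℝ → ℝ} (hF : IsRegularTail α F) {c κ : ℝ}
    (hg : Tendsto (fun t => g t / F t) atTop (𝓝 c)) (hκ : 0 < κ) :
    Tendsto (fun t => g (κ * t) / F t) atTop (𝓝 (c * κ ^ (-α))) := by
  have hct : Tendsto (fun t : ℝ => κ * t) atTop atTop := tendsto_id.const_mul_atTop hκ
  refine ((hg.comp hct).mul (hF.tendsto_ratio κ hκ)).congr fun t => ?_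
  have := (hF.pos (κ * t)).ne'
  simp only [Function.comp]
  field_simp

/-- A squeeze theorem in which the bounds depend on an auxiliary parameter. -/
lemma tendsto_of_parametric_bounds {ι β : Type*} {l : Filter ι} [l.NeBot] {k : Filter β}
    {f : β → ℝ} {c : ℝ} {U L : ι → ℝ} (hU : Tendsto U l (𝓝 c)) (hL : Tendsto L l (𝓝 c))
    (hu : ∀ᶠ i in l, ∃ u : β → ℝ, Tendsto u k (𝓝 (U i)) ∧ ∀ᶠ t in k, f t ≤ u t)
    (hl : ∀ᶠ i in l, ∃ u : β → ℝ, Tendsto u k (𝓝 (L i)) ∧ ∀ᶠ t in k, u t ≤ f t) :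
    Tendsto f k (𝓝 c) := by
  rw [tendsto_order]
  constructor
  · intro a ha
    obtain ⟨i, ⟨u, hu, hfu⟩, hi⟩ := (hl.and (hL.eventually_const_lt ha)).exists
    filter_upwards [hfu, hu.eventually_const_lt hi] with t h1 h2
    exact h2.trans_le h1
  · intro a ha
    obtain ⟨i, ⟨u, hu, hfu⟩, hi⟩ := (hu.and (hU.eventually_lt_const ha)).exists
    filter_upwards [hfu, hu.eventually_lt_const hi] with t h1 h2
    exact h1.trans_lt h2

lemma measureReal_le_integral {Ω : Type*} [MeasurableSpace Ω] {P : Measure Ω} [IsFiniteMeasure P]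
    {A : Set Ω} (hA : MeasurableSet A) {g : Ω → ℝ} (hg : Integrable g P) (h0 : ∀ ω, 0 ≤ g ω)
    (h1 : ∀ ω ∈ A, 1 ≤ g ω) : P.real A ≤ ∫ ω, g ω ∂P := by
  rw [← integral_indicator_one hA]
  refine integral_mono ((integrable_const 1).indicator hA) hg fun ω => ?_
  by_cases hω : ω ∈ A
  · simpa [hω] using h1 ω hω
  · simpa [hω] using h0 ω

section

variable {Ω : Type*} [MeasurableSpace Ω] {P : Measure Ω} [IsProbabilityMeasure P]

/-- The tail of a product of a bounded variable and an independent variable with a regularly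
varying tail. -/
lemma IsRegularTail.tendsto_product {α : ℝ} (hα : 0 < α) {F : ℝ → ℝ} (hF : IsRegularTail α F)
    {ξ : Ω → ℝ} (hξ : Measurable ξ) (hξ01 : ∀ ω, ξ ω ∈ Set.Icc (0 : ℝ) 1)
    (ν : Measure ℕ) [IsProbabilityMeasure ν] {c : ℝ}
    (hν : Tendsto (fun t : ℝ => ν.real {x : ℕ | t < (x : ℝ)} / F t) atTop (𝓝 c)) :
    Tendsto (fun t : ℝ => (∫ ω, ν.real {x : ℕ | t < ξ ω * (x : ℝ)} ∂P) / F t) atTop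
      (𝓝 (c * ∫ ω, ξ ω ^ α ∂P)) := by
  simp only [← integral_div, ← integral_const_mul]
  have hb : ∀ᶠ t in atTop, ν.real {x : ℕ | t < (x : ℝ)} / F t ≤ c + 1 :=
    hν.eventually_le_const (by linarith)
  refine tendsto_integral_filter_of_dominated_convergence (fun _ => c + 1)
    (Eventually.of_forall fun t => ?_) ?_ (integrable_const _) (Eventually.of_forall fun ω => ?_)
  · have hm : Monotone (fun p : ℝ => ν.real {x : ℕ | t < p * (x : ℝ)}) := fun p q hpq =>
      measureReal_mono fun x hx => lt_of_lt_of_le hx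
        (mul_le_mul_of_nonneg_right hpq (Nat.cast_nonneg x))
    exact ((hm.measurable.comp hξ).div_const _).aestronglyMeasurable
  · filter_upwards [hb] with t ht
    refine Eventually.of_forall fun ω => ?_
    rw [Real.norm_eq_abs, abs_of_nonneg (div_nonneg measureReal_nonneg (hF.pos t).le)]
    refine le_trans ?_ ht
    refine div_le_div_of_nonneg_right (measureReal_mono fun x hx => ?_) (hF.pos t).le
    exact lt_of_lt_of_le hx (mul_le_of_le_one_left (Nat.cast_nonneg x) (hξ01 ω).2)
  · rcases (hξ01 ω).1.eq_or_lt with h0 | hpos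
    -- At `ξ ω = 0` the product never exceeds `t ≥ 0`, and `0 ^ α = 0` because `α > 0`. For `ξ ω >
    -- 0` the event is `(ξ ω)⁻¹ t < x`, and regular variation produces `(ξ ω) ^ α`.
    · rw [← h0, Real.zero_rpow hα.ne', mul_zero]
      refine tendsto_const_nhds.congr' ?_
      filter_upwards [eventually_ge_atTop 0] with t ht
      simp [not_lt.2 ht]
    · have := hF.tendsto_comp_mul hν (inv_pos.2 hpos)
      rw [Real.inv_rpow hpos.le, Real.rpow_neg hpos.le, inv_inv] at this
      refine this.congr fun t => ?_
      congr 2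
      ext x
      simp only [Set.mem_ofPred_eq]
      rw [inv_mul_lt_iff₀ hpos]

/-! ### Tail of the thinning and of one step. -/

variable {φ : ℤ → Ω → ℝ} {Z : ℤ → Ω → ℕ} {B : ℤ → ℕ → Ω → ℕ}

lemma integral_measureReal_swap (ν : Measure ℕ) [IsProbabilityMeasure ν] {ξ : Ω → ℝ}
    (hξ : Measurable ξ) (t : ℝ) :
    ∫ x, P.real {ω | t < ξ ω * (x : ℝ)} ∂ν = ∫ ω, ν.real {x : ℕ | t < ξ ω * (x : ℝ)} ∂P := by
  have hm : MeasurableSet {p : ℕ × Ω | t < ξ p.2 * (p.1 : ℝ)} :=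
    measurableSet_lt measurable_const
      ((hξ.comp measurable_snd).mul (measurable_from_top.comp measurable_fst))
  have hmono : Monotone (fun p : ℝ => ν.real {x : ℕ | t < p * (x : ℝ)}) := fun p q hpq =>
      measureReal_mono fun x hx => lt_of_lt_of_le hx
        (mul_le_mul_of_nonneg_right hpq (Nat.cast_nonneg x))
  rw [integral_eq_lintegral_of_nonneg_ae (Eventually.of_forall fun x => measureReal_nonneg)
      measurable_from_top.aestronglyMeasurable,
    integral_eq_lintegral_of_nonneg_ae (Eventually.of_forall fun x => measureReal_nonneg)
      (hmono.measurable.comp hξ).aestronglyMeasurable]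
  refine congrArg ENNReal.toReal ?_
  exact (lintegral_congr fun x => ofReal_measureReal).trans <| (Measure.prod_apply hm).symm.trans <|
    (Measure.prod_apply_symm hm).trans (lintegral_congr fun ω => (ofReal_measureReal).symm)

/-- Chebyshev conditionally on `φ`: if `φ x ≤ (1 - ε) t`, exceeding `t` is a deviation of at least
`ε t`, while the conditional variance is at most `φ x ≤ t`. The weight `ψ` localizes to this event.
Since thinning cannot exceed `x`, the error lives on `x > t`; integrated, it is the tail of the
state times `O(1 / t)`, hence negligible. -/
lemma IsRCINARCoefficients.thinning_tail_le (h : IsRCINARCoefficients P φ Z B) (x : ℕ)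
    {t ε : ℝ} (ht : 0 < t) (hε : 0 < ε) :
    P.real {ω | t < (thinning B x ω : ℝ)} ≤ P.real {ω | (1 - ε) * t < φ 1 ω * x} +
      Set.indicator {x : ℕ | t < (x : ℝ)} (fun _ => (ε ^ 2 * t)⁻¹) x := by
  by_cases hx : t < (x : ℝ)
  swap
  · have : {ω | t < (thinning B x ω : ℝ)} = ∅ := by
      ext ω
      simp only [Set.mem_ofPred_eq, Set.mem_empty_iff_false, iff_false, not_lt]
      exact le_trans (by exact_mod_cast h.thinning_le x ω) (not_lt.1 hx)
    simp [this, hx, measureReal_nonneg]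
  have mφ := h.measurable_phi 1
  have mS : Measurable (fun ω => (thinning B x ω : ℝ)) :=
    measurable_from_top.comp (h.measurable_thinning x)
  set ψ : ℝ → ℝ := Set.indicator {p | p * x ≤ (1 - ε) * t} (fun _ => 1) with hψ
  have mψ : Measurable ψ :=
    measurable_const.indicator (measurableSet_le (measurable_id.mul_const _) measurable_const)
  have hψ0 (p : ℝ) : 0 ≤ ψ p := Set.indicator_nonneg (fun _ _ => zero_le_one) p
  have hψ1 (p : ℝ) : |ψ p| ≤ 1 := by
    rw [abs_of_nonneg (hψ0 p)]
    exact Set.indicator_le_self' (f := fun _ => (1 : ℝ)) (fun _ _ => zero_le_one) p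
  set A : Set Ω := {ω | φ 1 ω * x ≤ (1 - ε) * t ∧ t < (thinning B x ω : ℝ)} with hA
  have mA : MeasurableSet A :=
    (measurableSet_le (mφ.mul_const _) measurable_const).inter
      (measurableSet_lt measurable_const mS)
  have bS (ω : Ω) : |((thinning B x ω : ℝ) - x * φ 1 ω) ^ 2| ≤ (x : ℝ) ^ 2 := by
    have h1 : (thinning B x ω : ℝ) ≤ x := by exact_mod_cast h.thinning_le x ω
    have h2 : (0 : ℝ) ≤ thinning B x ω := Nat.cast_nonneg _
    have h3 := (h.phi_mem 1 ω).1
    have h4 := (h.phi_mem 1 ω).2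
    have h5 : (x : ℝ) * φ 1 ω ≤ x := mul_le_of_le_one_right (Nat.cast_nonneg x) h4
    have h6 : 0 ≤ (x : ℝ) * φ 1 ω := mul_nonneg (Nat.cast_nonneg x) h3
    rw [abs_of_nonneg (sq_nonneg _)]
    exact sq_le_sq' (by linarith) (by linarith)
  have hint : Integrable (fun ω => ψ (φ 1 ω) * ((thinning B x ω : ℝ) - x * φ 1 ω) ^ 2) P :=
    h.integrable_mul ψ mψ 1 hψ1 _ ((mS.sub (mφ.const_mul _)).pow_const 2) _ bS
  have hPA : P.real A ≤ (ε ^ 2 * t)⁻¹ := by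
    calc P.real A ≤ ∫ ω, (ψ (φ 1 ω) * ((thinning B x ω : ℝ) - x * φ 1 ω) ^ 2) / (ε * t) ^ 2 ∂P := by
          refine measureReal_le_integral mA (hint.div_const _)
            (fun ω => div_nonneg (mul_nonneg (hψ0 _) (sq_nonneg _)) (sq_nonneg _)) ?_
          rintro ω ⟨h1, h2⟩
          have e : ψ (φ 1 ω) = 1 := Set.indicator_of_mem (s := {p : ℝ | p * x ≤ (1 - ε) * t}) h1 _
          rw [e, one_mul, le_div_iff₀ (by positivity), one_mul]
          exact pow_le_pow_left₀ (by positivity) (by linarith) 2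
      _ = (∫ ω, ψ (φ 1 ω) * (x * φ 1 ω * (1 - φ 1 ω)) ∂P) / (ε * t) ^ 2 := by
          rw [integral_div, h.integral_mul_sq_sub x ψ mψ 1 hψ1]
      _ ≤ t / (ε * t) ^ 2 := by
          refine div_le_div_of_nonneg_right ?_ (sq_nonneg _)
          calc ∫ ω, ψ (φ 1 ω) * (x * φ 1 ω * (1 - φ 1 ω)) ∂P ≤ ∫ _ω, t ∂P := by
                refine integral_mono_of_nonneg (Eventually.of_forall fun ω => ?_)
                  (integrable_const _) (Eventually.of_forall fun ω => ?_)
                · exact mul_nonneg (hψ0 _) (mul_nonneg (mul_nonneg (Nat.cast_nonneg _)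
                    (h.phi_mem 1 ω).1) (by linarith [(h.phi_mem 1 ω).2]))
                · have h3 := (h.phi_mem 1 ω).1
                  have h4 := (h.phi_mem 1 ω).2
                  by_cases hc : φ 1 ω * x ≤ (1 - ε) * t
                  · have e : ψ (φ 1 ω) = 1 :=
                      Set.indicator_of_mem (s := {p : ℝ | p * x ≤ (1 - ε) * t}) hc _
                    have h6 : 0 ≤ (x : ℝ) * φ 1 ω := mul_nonneg (Nat.cast_nonneg x) h3
                    simp only [e, one_mul]
                    nlinarith [mul_pos hε ht]
                  · have e : ψ (φ 1 ω) = 0 :=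
                      Set.indicator_of_notMem (s := {p : ℝ | p * x ≤ (1 - ε) * t}) hc _
                    simp only [e, zero_mul]
                    exact ht.le
            _ = t := by simp
      _ = (ε ^ 2 * t)⁻¹ := by field_simp
  calc P.real {ω | t < (thinning B x ω : ℝ)}
      ≤ P.real ({ω | (1 - ε) * t < φ 1 ω * x} ∪ A) := measureReal_mono fun ω hω => by
        rcases lt_or_ge ((1 - ε) * t) (φ 1 ω * x) with hc | hc
        exacts [Or.inl hc, Or.inr ⟨hc, hω⟩]
    _ ≤ P.real {ω | (1 - ε) * t < φ 1 ω * x} + P.real A := measureReal_union_le _ _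
    _ ≤ _ := by
        rw [Set.indicator_of_mem (s := {x : ℕ | t < (x : ℝ)}) hx]
        gcongr

/-- Here `φ x` is unbounded above on the relevant event, so Chebyshev is applied to the relative
deviation, which is at least `ε / (1 + ε)`. Dividing by `(φ x) ^ 2` through `ψ` leaves a variance of
at most `1 / (φ x)`, hence at most `1 / ((1 + ε) t)`. -/
lemma IsRCINARCoefficients.le_thinning_tail (h : IsRCINARCoefficients P φ Z B) (x : ℕ)
    {t ε : ℝ} (ht : 0 < t) (hε : 0 < ε) :
    P.real {ω | (1 + ε) * t < φ 1 ω * x} ≤ P.real {ω | t < (thinning B x ω : ℝ)} +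
      Set.indicator {x : ℕ | t < (x : ℝ)} (fun _ => (1 + ε) / (ε ^ 2 * t)) x := by
  by_cases hx : t < (x : ℝ)
  swap
  · have : {ω | (1 + ε) * t < φ 1 ω * x} = ∅ := by
      ext ω
      simp only [Set.mem_ofPred_eq, Set.mem_empty_iff_false, iff_false, not_lt]
      have h5 : φ 1 ω * (x : ℝ) ≤ x := mul_le_of_le_one_left (Nat.cast_nonneg x) (h.phi_mem 1 ω).2
      nlinarith [mul_pos hε ht]
    simp [this, hx, measureReal_nonneg]
  have mφ := h.measurable_phi 1
  have mS : Measurable (fun ω => (thinning B x ω : ℝ)) :=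
    measurable_from_top.comp (h.measurable_thinning x)
  set ψ : ℝ → ℝ := Set.indicator {p | (1 + ε) * t < p * x} (fun p => ((p * x) ^ 2)⁻¹) with hψ
  have mψ : Measurable ψ :=
    ((measurable_id.mul_const _).pow_const 2).inv.indicator
      (measurableSet_lt measurable_const (measurable_id.mul_const _))
  have hψ0 (p : ℝ) : 0 ≤ ψ p := Set.indicator_nonneg (fun _ _ => by positivity) p
  have hεt : 0 < (1 + ε) * t := by positivity
  have hψ1 (p : ℝ) : |ψ p| ≤ (((1 + ε) * t) ^ 2)⁻¹ := by
    rw [abs_of_nonneg (hψ0 p)]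
    refine Set.indicator_apply_le' (fun hp => ?_) (fun _ => by positivity)
    exact inv_anti₀ (by positivity) (pow_le_pow_left₀ hεt.le (le_of_lt hp) 2)
  set A : Set Ω := {ω | (1 + ε) * t < φ 1 ω * x ∧ (thinning B x ω : ℝ) ≤ t} with hA
  have mA : MeasurableSet A :=
    (measurableSet_lt measurable_const (mφ.mul_const _)).inter
      (measurableSet_le mS measurable_const)
  have bS (ω : Ω) : |((thinning B x ω : ℝ) - x * φ 1 ω) ^ 2| ≤ (x : ℝ) ^ 2 := by
    have h1 : (thinning B x ω : ℝ) ≤ x := by exact_mod_cast h.thinning_le x ω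
    have h2 : (0 : ℝ) ≤ thinning B x ω := Nat.cast_nonneg _
    have h3 := (h.phi_mem 1 ω).1
    have h4 := (h.phi_mem 1 ω).2
    have h5 : (x : ℝ) * φ 1 ω ≤ x := mul_le_of_le_one_right (Nat.cast_nonneg x) h4
    have h6 : 0 ≤ (x : ℝ) * φ 1 ω := mul_nonneg (Nat.cast_nonneg x) h3
    rw [abs_of_nonneg (sq_nonneg _)]
    exact sq_le_sq' (by linarith) (by linarith)
  have hint : Integrable (fun ω => ψ (φ 1 ω) * ((thinning B x ω : ℝ) - x * φ 1 ω) ^ 2) P :=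
    h.integrable_mul ψ mψ _ hψ1 _ ((mS.sub (mφ.const_mul _)).pow_const 2) _ bS
  have hPA : P.real A ≤ (1 + ε) / (ε ^ 2 * t) := by
    calc P.real A ≤ ∫ ω, (ψ (φ 1 ω) * ((thinning B x ω : ℝ) - x * φ 1 ω) ^ 2) *
            ((1 + ε) / ε) ^ 2 ∂P := by
          refine measureReal_le_integral mA (hint.mul_const _)
            (fun ω => mul_nonneg (mul_nonneg (hψ0 _) (sq_nonneg _)) (sq_nonneg _)) ?_
          rintro ω ⟨h1, h2⟩
          have e : ψ (φ 1 ω) = ((φ 1 ω * x) ^ 2)⁻¹ :=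
            Set.indicator_of_mem (s := {p : ℝ | (1 + ε) * t < p * x}) h1 _
          have hu : 0 < φ 1 ω * x := hεt.trans h1
          have h3 : 1 ≤ ((φ 1 ω * x - thinning B x ω) / (φ 1 ω * x)) * ((1 + ε) / ε) := by
            rw [div_mul_div_comm, le_div_iff₀ (by positivity)]
            nlinarith
          rw [e]
          calc (1 : ℝ) ≤ (((φ 1 ω * x - thinning B x ω) / (φ 1 ω * x)) * ((1 + ε) / ε)) ^ 2 :=
                one_le_pow₀ h3
            _ = _ := by
              rw [mul_pow, div_pow]
              ring
      _ = (∫ ω, ψ (φ 1 ω) * (x * φ 1 ω * (1 - φ 1 ω)) ∂P) * ((1 + ε) / ε) ^ 2 := by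
          rw [integral_mul_const, h.integral_mul_sq_sub x ψ mψ _ hψ1]
      _ ≤ ((1 + ε) * t)⁻¹ * ((1 + ε) / ε) ^ 2 := by
          refine mul_le_mul_of_nonneg_right ?_ (sq_nonneg _)
          calc ∫ ω, ψ (φ 1 ω) * (x * φ 1 ω * (1 - φ 1 ω)) ∂P ≤ ∫ _ω, ((1 + ε) * t)⁻¹ ∂P := by
                refine integral_mono_of_nonneg (Eventually.of_forall fun ω => ?_)
                  (integrable_const _) (Eventually.of_forall fun ω => ?_)
                · exact mul_nonneg (hψ0 _) (mul_nonneg (mul_nonneg (Nat.cast_nonneg _)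
                    (h.phi_mem 1 ω).1) (by linarith [(h.phi_mem 1 ω).2]))
                · have h3 := (h.phi_mem 1 ω).1
                  have h4 := (h.phi_mem 1 ω).2
                  by_cases hc : (1 + ε) * t < φ 1 ω * x
                  · have e : ψ (φ 1 ω) = ((φ 1 ω * x) ^ 2)⁻¹ :=
                      Set.indicator_of_mem (s := {p : ℝ | (1 + ε) * t < p * x}) hc _
                    have hu : 0 < φ 1 ω * x := hεt.trans hc
                    have e2 : ((φ 1 ω * x) ^ 2)⁻¹ * (x * φ 1 ω * (1 - φ 1 ω)) =
                        (φ 1 ω * x)⁻¹ * (1 - φ 1 ω) := by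
                      rw [mul_comm (x : ℝ)]
                      generalize φ 1 ω * x = u at hu
                      field_simp
                    simp only [e, e2]
                    calc (φ 1 ω * x)⁻¹ * (1 - φ 1 ω) ≤ (φ 1 ω * x)⁻¹ :=
                          mul_le_of_le_one_right (by positivity) (by linarith)
                      _ ≤ _ := inv_anti₀ hεt hc.le
                  · have e : ψ (φ 1 ω) = 0 :=
                      Set.indicator_of_notMem (s := {p : ℝ | (1 + ε) * t < p * x}) hc _
                    simp only [e, zero_mul]
                    positivity
            _ = ((1 + ε) * t)⁻¹ := by simp
      _ = (1 + ε) / (ε ^ 2 * t) := by field_simp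
  calc P.real {ω | (1 + ε) * t < φ 1 ω * x}
      ≤ P.real ({ω | t < (thinning B x ω : ℝ)} ∪ A) := measureReal_mono fun ω hω => by
        rcases lt_or_ge t (thinning B x ω : ℝ) with hc | hc
        exacts [Or.inl hc, Or.inr ⟨hω, hc⟩]
    _ ≤ P.real {ω | t < (thinning B x ω : ℝ)} + P.real A := measureReal_union_le _ _
    _ ≤ _ := by
        rw [Set.indicator_of_mem (s := {x : ℕ | t < (x : ℝ)}) hx]
        gcongr

end

section

variable {Ω : Type*} [MeasurableSpace Ω] {P : Measure Ω} [IsProbabilityMeasure P]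
  {φ : ℤ → Ω → ℝ} {Z : ℤ → Ω → ℕ} {B : ℤ → ℕ → Ω → ℕ}

/-- The tail of the thinning of a variable with a regularly varying tail. -/
lemma IsRCINARCoefficients.tendsto_thinning_tail (h : IsRCINARCoefficients P φ Z B)
    {α : ℝ} (hα : 0 < α) {F : ℝ → ℝ} (hF : IsRegularTail α F)
    (ν : Measure ℕ) [IsProbabilityMeasure ν] {c : ℝ}
    (hν : Tendsto (fun t : ℝ => ν.real {x : ℕ | t < (x : ℝ)} / F t) atTop (𝓝 c)) :
    Tendsto (fun t : ℝ => (∫ x, P.real {ω | t < (thinning B x ω : ℝ)} ∂ν) / F t) atTop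
      (𝓝 (c * ∫ ω, φ 0 ω ^ α ∂P)) := by
  set ρ := ∫ ω, φ 0 ω ^ α ∂P with hρ
  have hρ1 : ∫ ω, φ 1 ω ^ α ∂P = ρ :=
    ((h.phi_ident 1).comp (measurable_id.pow_const α)).integral_eq
  set G : ℝ → ℝ := fun t => ∫ x, P.real {ω | t < φ 1 ω * (x : ℝ)} ∂ν with hG
  have hGlim : Tendsto (fun t => G t / F t) atTop (𝓝 (c * ρ)) := by
    rw [← hρ1]
    simp only [hG, integral_measureReal_swap ν (h.measurable_phi 1)]
    exact hF.tendsto_product hα (h.measurable_phi 1) (h.phi_mem 1) ν hν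
  have hind (t a : ℝ) : ∫ x, Set.indicator {x : ℕ | t < (x : ℝ)} (fun _ => a) x ∂ν =
      ν.real {x : ℕ | t < (x : ℝ)} * a := by
    rw [integral_indicator_const _ MeasurableSet.of_discrete, smul_eq_mul]
  have hindint (t a : ℝ) : Integrable (Set.indicator {x : ℕ | t < (x : ℝ)} (fun _ => a)) ν :=
    (integrable_const a).indicator MeasurableSet.of_discrete
  have hinv (a : ℝ) : Tendsto (fun t : ℝ => a * t⁻¹) atTop (𝓝 0) := by
    simpa using tendsto_inv_atTop_zero.const_mul a
  have hpow (s : ℝ) : Tendsto (fun ε : ℝ => c * ρ * (1 + s * ε) ^ (-α)) (𝓝[>] 0)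
      (𝓝 (c * ρ)) := by
    have : ContinuousAt (fun ε : ℝ => c * ρ * (1 + s * ε) ^ (-α)) 0 := by
      refine continuousAt_const.mul (ContinuousAt.rpow_const (by fun_prop) (Or.inl (by simp)))
    have := this.tendsto
    simp only [mul_zero, add_zero, Real.one_rpow, mul_one] at this
    exact this.mono_left nhdsWithin_le_nhds
  refine tendsto_of_parametric_bounds (hpow (-1)) (hpow 1) ?_ ?_
  · filter_upwards [Ioo_mem_nhdsGT (zero_lt_one (α := ℝ))] with ε hε
    refine ⟨fun t => G ((1 + -1 * ε) * t) / F t + ν.real {x : ℕ | t < (x : ℝ)} / F t *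
      ((ε ^ 2)⁻¹ * t⁻¹), ?_, ?_⟩
    · simpa using (hF.tendsto_comp_mul hGlim (κ := 1 + -1 * ε) (by linarith [hε.2])).add
        (hν.mul (hinv (ε ^ 2)⁻¹))
    · filter_upwards [eventually_gt_atTop 0] with t ht
      have := integral_mono (μ := ν) (integrable_measureReal ν _)
        ((integrable_measureReal ν _).add (hindint _ _))
        fun x => h.thinning_tail_le x ht hε.1
      simp only [Pi.add_apply] at this
      rw [integral_add (integrable_measureReal ν _) (hindint _ _), hind] at this
      rw [div_mul_eq_mul_div, ← add_div]
      refine div_le_div_of_nonneg_right (this.trans_eq ?_) (hF.pos t).le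
      simp only [hG, mul_inv]
      ring_nf
  · filter_upwards [self_mem_nhdsWithin] with ε hε
    rw [Set.mem_Ioi] at hε
    refine ⟨fun t => G ((1 + 1 * ε) * t) / F t - ν.real {x : ℕ | t < (x : ℝ)} / F t *
      ((1 + ε) / ε ^ 2 * t⁻¹), ?_, ?_⟩
    · simpa using (hF.tendsto_comp_mul hGlim (κ := 1 + 1 * ε) (by linarith)).sub
        (hν.mul (hinv ((1 + ε) / ε ^ 2)))
    · filter_upwards [eventually_gt_atTop 0] with t ht
      have := integral_mono (μ := ν) (integrable_measureReal ν _)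
        ((integrable_measureReal ν _).add (hindint _ _))
        fun x => h.le_thinning_tail x ht hε
      simp only [Pi.add_apply] at this
      rw [integral_add (integrable_measureReal ν _) (hindint _ _), hind] at this
      rw [div_mul_eq_mul_div, ← sub_div]
      refine div_le_div_of_nonneg_right ?_ (hF.pos t).le
      rw [sub_le_iff_le_add]
      refine Eq.trans_le ?_ (this.trans_eq ?_)
      · simp only [hG, one_mul]
      · congr 2
        rw [div_mul_eq_div_div, div_eq_mul_inv _ t]

/-- The tail after one step of the process, when the tails of the initial state and of the
immigration are comparable to a regularly varying function. -/
lemma IsRCINARCoefficients.tendsto_stepLaw_tail (h : IsRCINARCoefficients P φ Z B)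
    {α : ℝ} (hα : 0 < α)
    (hF : IsRegularTail α (fun t : ℝ => P.real {ω | t < (Z 0 ω : ℝ)}))
    (ν : Measure ℕ) [IsProbabilityMeasure ν] {c : ℝ}
    (hν : Tendsto (fun t : ℝ => ν.real {x : ℕ | t < (x : ℝ)} / P.real {ω | t < (Z 0 ω : ℝ)})
      atTop (𝓝 c)) :
    Tendsto (fun t : ℝ => (stepLaw P Z B ν).real {x : ℕ | t < (x : ℝ)} /
      P.real {ω | t < (Z 0 ω : ℝ)}) atTop (𝓝 (c * (∫ ω, φ 0 ω ^ α ∂P) + 1)) := by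
  have hG := h.tendsto_thinning_tail hα hF ν hν
  set F : ℝ → ℝ := fun t => P.real {ω | t < (Z 0 ω : ℝ)} with hFdef
  set G : ℝ → ℝ := fun t => ∫ x, P.real {ω | t < (thinning B x ω : ℝ)} ∂ν with hGdef
  set a := c * ∫ ω, φ 0 ω ^ α ∂P with ha
  have hZ (s : ℝ) : P.real {ω | s < (Z 1 ω : ℝ)} = F s := by
    have := (h.Z_ident 1).measure_preimage_eq (s := {n : ℕ | s < (n : ℝ)})
      MeasurableSet.of_discrete
    exact congrArg ENNReal.toReal this
  have hFF : Tendsto (fun t => F t / F t) atTop (𝓝 1) :=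
    tendsto_const_nhds.congr fun t => (div_self (hF.pos t).ne').symm
  have hstep (t : ℝ) : (stepLaw P Z B ν).real {x : ℕ | t < (x : ℝ)} =
      ∫ x, P.real {ω | t < (thinning B x ω : ℝ) + (Z 1 ω : ℝ)} ∂ν := by
    rw [h.stepLaw_real_eq_integral]
    simp only [Set.mem_ofPred_eq, Nat.cast_add]
  have hI (A : ℕ → Set Ω) := integrable_measureReal (P := P) ν A
  have hmeasZ (s : ℝ) : MeasurableSet {ω | s < (Z 1 ω : ℝ)} :=
    measurableSet_lt measurable_const (measurable_from_top.comp (h.measurable_Z 1))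
  have hpow : Tendsto (fun ε : ℝ => (a + 1) * (1 - ε) ^ (-α)) (𝓝[>] 0) (𝓝 (a + 1)) := by
    have : ContinuousAt (fun ε : ℝ => (a + 1) * (1 - ε) ^ (-α)) 0 := by
      refine continuousAt_const.mul (ContinuousAt.rpow_const (by fun_prop) (Or.inl (by simp)))
    have := this.tendsto
    simp only [sub_zero, Real.one_rpow, mul_one] at this
    exact this.mono_left nhdsWithin_le_nhds
  refine tendsto_of_parametric_bounds (l := 𝓝[>] (0 : ℝ)) hpow tendsto_const_nhds ?_
    (Eventually.of_forall fun _ => ?_)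
  · filter_upwards [Ioo_mem_nhdsGT (zero_lt_one (α := ℝ))] with ε hε
    have h1ε : 0 < 1 - ε := by linarith [hε.2]
    -- If the sum exceeds `t`, then one term exceeds `(1 - ε) t` or both exceed `ε t`. By
    -- independence the latter costs a product of two tails, which is `o(F t)`.
    refine ⟨fun t => G ((1 - ε) * t) / F t + F ((1 - ε) * t) / F t + G (ε * t) / F t * F (ε * t),
      ?_, Eventually.of_forall fun t => ?_⟩
    · have h3 : Tendsto (fun t => F (ε * t)) atTop (𝓝 0) :=
        hF.tendsto_zero.comp (tendsto_id.const_mul_atTop hε.1)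
      have := ((hF.tendsto_comp_mul hG h1ε).add (hF.tendsto_comp_mul hFF h1ε)).add
        ((hF.tendsto_comp_mul hG hε.1).mul h3)
      rwa [mul_zero, add_zero, ← add_mul] at this
    · beta_reduce
      rw [show P.real {ω | t < (Z 0 ω : ℝ)} = F t from rfl, div_mul_eq_mul_div, ← add_div, ← add_div, hstep]
      refine div_le_div_of_nonneg_right ?_ (hF.pos t).le
      have hx (x : ℕ) : P.real {ω | t < (thinning B x ω : ℝ) + (Z 1 ω : ℝ)} ≤
          P.real {ω | (1 - ε) * t < (thinning B x ω : ℝ)} + F ((1 - ε) * t) +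
            P.real {ω | ε * t < (thinning B x ω : ℝ)} * F (ε * t) := by
        rw [← hZ, ← hZ, ← h.measureReal_thinning_inter]
        refine (measureReal_mono fun ω hω => ?_).trans ((measureReal_union_le
          ({ω | (1 - ε) * t < (thinning B x ω : ℝ)} ∪ {ω | (1 - ε) * t < (Z 1 ω : ℝ)}) _).trans
          (add_le_add_left (measureReal_union_le _ _) _))
        simp only [Set.mem_union, Set.mem_inter_iff, Set.mem_ofPred_eq] at hω ⊢
        by_contra! hcon
        obtain ⟨⟨h1, h2⟩, h3⟩ := hcon
        have := h3 (by linarith)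
        linarith
      have := integral_mono (μ := ν) (hI _) (((hI _).add (integrable_const _)).add
        ((hI _).mul_const _)) hx
      refine this.trans_eq ?_
      have J : Integrable (fun x => P.real {ω | (1 - ε) * t < (thinning B x ω : ℝ)} +
        F ((1 - ε) * t)) ν := (hI _).add (integrable_const _)
      simp only [Pi.add_apply]
      rw [integral_add J ((hI _).mul_const _), integral_mul_const,
        integral_add (hI _) (integrable_const _)]
      simp [hGdef, hFdef]
  -- Both terms being nonnegative, the sum exceeds `t` whenever either does; inclusion-exclusion
  -- again leaves a negligible product.
  · refine ⟨fun t => G t / F t + F t / F t - G t / F t * F t, ?_, Eventually.of_forall fun t => ?_⟩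
    · simpa using (hG.add hFF).sub (hG.mul hF.tendsto_zero)
    · beta_reduce
      rw [show P.real {ω | t < (Z 0 ω : ℝ)} = F t from rfl, div_mul_eq_mul_div, ← add_div, ← sub_div, hstep]
      refine div_le_div_of_nonneg_right ?_ (hF.pos t).le
      have hx (x : ℕ) : P.real {ω | t < (thinning B x ω : ℝ)} + F t -
          P.real {ω | t < (thinning B x ω : ℝ)} * F t ≤
          P.real {ω | t < (thinning B x ω : ℝ) + (Z 1 ω : ℝ)} := by
        rw [← hZ, ← h.measureReal_thinning_inter, ← measureReal_union_add_inter (hmeasZ t),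
          add_sub_cancel_right]
        refine measureReal_mono fun ω hω => ?_
        have h1 : (0 : ℝ) ≤ thinning B x ω := Nat.cast_nonneg _
        have h2 : (0 : ℝ) ≤ Z 1 ω := Nat.cast_nonneg _
        simp only [Set.mem_union, Set.mem_ofPred_eq] at hω ⊢
        rcases hω with hω | hω <;> linarith
      have := integral_mono (μ := ν) (((hI _).add (integrable_const _)).sub
        ((hI _).mul_const _)) (hI _) hx
      refine Eq.trans_le ?_ this
      have J : Integrable (fun x => P.real {ω | t < (thinning B x ω : ℝ)} + F t) ν :=
        (hI _).add (integrable_const _)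
      simp only [Pi.sub_apply, Pi.add_apply]
      rw [integral_sub J ((hI _).mul_const _), integral_mul_const,
        integral_add (hI _) (integrable_const _)]
      simp [hGdef, hFdef]

end

/-! ### A law decreased by one step, and the tail of the limit. -/

lemma StochLE.tail_le {μ ν : Measure ℕ} [IsProbabilityMeasure μ] [IsProbabilityMeasure ν]
    (h : StochLE μ ν) (t : ℝ) :
    μ.real {x : ℕ | t < (x : ℝ)} ≤ ν.real {x : ℕ | t < (x : ℝ)} := by
  have hu : IsUpperSet {x : ℕ | t < (x : ℝ)} := fun a b hab ha =>
    lt_of_lt_of_le (α := ℝ) ha (Nat.cast_le.2 hab)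
  rcases isUpperSet_nat_cases hu with e | ⟨m, e⟩
  · simp [e]
  · rw [e]
    exact h m

lemma stochLE_of_tail_le {μ ν : Measure ℕ}
    (h : ∀ t : ℝ, μ.real {x : ℕ | t < (x : ℝ)} ≤ ν.real {x : ℕ | t < (x : ℝ)}) : StochLE μ ν := by
  intro m
  have e : Set.Ici m = {x : ℕ | (m : ℝ) - 1 < (x : ℝ)} := by
    ext x
    simp only [Set.mem_Ici, Set.mem_ofPred_eq, sub_lt_iff_lt_add]
    norm_cast
    omega
  rw [e]
  exact h _

section

variable {Ω : Type*} [MeasurableSpace Ω] {P : Measure Ω} [IsProbabilityMeasure P]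
  {φ : ℤ → Ω → ℝ} {Z : ℤ → Ω → ℕ} {B : ℤ → ℕ → Ω → ℕ}

lemma integral_rpow_lt_one {ξ : Ω → ℝ} (hξ : Measurable ξ) (hξ01 : ∀ ω, ξ ω ∈ Set.Icc (0 : ℝ) 1)
    (h1 : P {ω | ξ ω = 1} < 1) {a : ℝ} (ha : 0 < a) : ∫ ω, ξ ω ^ a ∂P < 1 := by
  have hle (ω : Ω) : ξ ω ^ a ≤ 1 := Real.rpow_le_one (hξ01 ω).1 (hξ01 ω).2 ha.le
  have hint : Integrable (fun ω => ξ ω ^ a) P :=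
    Integrable.of_bound (hξ.pow_const a).aestronglyMeasurable 1 (Eventually.of_forall fun ω => by
      rw [Real.norm_eq_abs, abs_of_nonneg (Real.rpow_nonneg (hξ01 ω).1 a)]; exact hle ω)
  have hnn : 0 ≤ fun ω => 1 - ξ ω ^ a := fun ω => sub_nonneg.2 (hle ω)
  have e : ∫ ω, (1 - ξ ω ^ a) ∂P = 1 - ∫ ω, ξ ω ^ a ∂P := by
    rw [integral_sub (integrable_const 1) hint]
    simp
  refine lt_of_le_of_ne (by linarith [integral_nonneg (μ := P) hnn]) fun heq => ?_
  rw [heq, sub_self, integral_eq_zero_iff_of_nonneg hnn ((integrable_const 1).sub hint)] at e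
  refine h1.ne ?_
  have hae : ∀ᵐ ω ∂P, ω ∈ {ω | ξ ω = 1} := by
    filter_upwards [e] with ω hω
    have h2 : ξ ω ^ a = 1 := by
      simp only [Pi.zero_apply] at hω
      linarith
    exact (Real.rpow_left_inj (hξ01 ω).1 zero_le_one ha.ne').1 (h2.trans (Real.one_rpow a).symm)
  exact (mem_ae_iff_prob_eq_one (hξ (measurableSet_singleton 1))).1 hae

/-- A law that is stochastically decreased by one step of the process: the law of the immigration
conditioned on being large. Its tail is a multiple of the tail of the immigration. -/
lemma IsRCINARCoefficients.exists_stochLE_stepLaw (h : IsRCINARCoefficients P φ Z B)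
    {α : ℝ} (hα : 0 < α) (hρ : ∫ ω, φ 0 ω ^ α ∂P < 1)
    (hF : IsRegularTail α (fun t : ℝ => P.real {ω | t < (Z 0 ω : ℝ)})) :
    ∃ κ : Measure ℕ, IsProbabilityMeasure κ ∧ StochLE (stepLaw P Z B κ) κ ∧
      ∃ c, Tendsto (fun t : ℝ => κ.real {x : ℕ | t < (x : ℝ)} / P.real {ω | t < (Z 0 ω : ℝ)})
        atTop (𝓝 c) := by
  set F : ℝ → ℝ := fun t => P.real {ω | t < (Z 0 ω : ℝ)} with hFdef
  set ρ := ∫ ω, φ 0 ω ^ α ∂P with hρdef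
  set μ : Measure ℕ := P.map (Z 0) with hμ
  have hμp : IsProbabilityMeasure μ :=
    Measure.isProbabilityMeasure_map (h.measurable_Z 0).aemeasurable
  set s : ℝ → Set ℕ := fun t => {x : ℕ | t < (x : ℝ)} with hs
  have hμF (t : ℝ) : μ.real (s t) = F t :=
    map_measureReal_apply (h.measurable_Z 0) MeasurableSet.of_discrete
  have hne (t : ℝ) : μ (s t) ≠ 0 := by
    intro h0
    have := hμF t
    rw [measureReal_def, h0] at this
    exact (hF.pos t).ne this
  set κ : ℝ → Measure ℕ := fun t => μ[|s t] with hκ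
  have hκp (t : ℝ) : IsProbabilityMeasure (κ t) := cond_isProbabilityMeasure (hne t)
  have hκint (T : ℝ) (g : ℕ → ℝ) : F T * ∫ x, g x ∂(κ T) = ∫ x in s T, g x ∂μ := by
    simp only [hκ, ProbabilityTheory.cond]
    rw [integral_smul_measure, ENNReal.toReal_inv, ← measureReal_def, hμF, smul_eq_mul,
      mul_inv_cancel_left₀ (hF.pos T).ne']
  have hκreal (T : ℝ) (A : Set ℕ) : (κ T).real A = (F T)⁻¹ * μ.real (s T ∩ A) := by
    rw [measureReal_def, measureReal_def, cond_apply MeasurableSet.of_discrete, ENNReal.toReal_mul,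
      ENNReal.toReal_inv, ← measureReal_def, hμF]
  have hanti : Antitone s := fun a b hab x hx => lt_of_le_of_lt hab hx
  have hκtail (T t : ℝ) (hTt : T ≤ t) : (κ T).real (s t) = F t / F T := by
    rw [hκreal, Set.inter_eq_self_of_subset_right (hanti hTt), hμF]
    ring
  have hκtail' (T t : ℝ) (hTt : t ≤ T) : (κ T).real (s t) = 1 := by
    rw [hκreal, Set.inter_eq_self_of_subset_left (hanti hTt), hμF, inv_mul_cancel₀ (hF.pos T).ne']
  have hκlim (T : ℝ) : Tendsto (fun t => (κ T).real (s t) / F t) atTop (𝓝 (F T)⁻¹) := by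
    refine tendsto_const_nhds.congr' ?_
    filter_upwards [eventually_ge_atTop T] with t ht
    rw [hκtail T t ht]
    have := (hF.pos t).ne'
    change (F T)⁻¹ = F t / F T / F t
    field_simp
  -- The tail constant of `κ T₀` is `c = (F T₀)⁻¹`, and `F T₀ < 1 - ρ` is exactly the condition `c ρ
  -- + 1 < c`. The tail of `stepLaw (κ T₀)` is thus eventually below `c F`; `T` is a level beyond
  -- which this holds.
  obtain ⟨T₀, hT₀⟩ := (hF.tendsto_zero.eventually_lt_const (sub_pos.2 hρ)).exists
  have hFT₀ : 0 < F T₀ := hF.pos T₀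
  have hlim := h.tendsto_stepLaw_tail hα hF (κ T₀) (hκlim T₀)
  have hc : (F T₀)⁻¹ * ρ + 1 < (F T₀)⁻¹ := by
    have : F T₀ < 1 - ρ := hT₀
    have h2 : 1 < (F T₀)⁻¹ * (1 - ρ) := by
      rwa [inv_mul_eq_div, one_lt_div hFT₀]
    linarith
  obtain ⟨T, hT, hTT₀⟩ :=
    ((eventually_forall_ge_atTop.2 (hlim.eventually_lt_const hc)).and
      (eventually_ge_atTop T₀)).exists
  refine ⟨κ T, hκp T, stochLE_of_tail_le fun t => ?_, _, hκlim T⟩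
  have := h.isProbabilityMeasure_stepLaw (κ T)
  change (stepLaw P Z B (κ T)).real (s t) ≤ (κ T).real (s t)
  rcases le_total t T with htT | htT
  · rw [hκtail' T t htT]
    exact measureReal_le_one
  · rw [hκtail T t htT, le_div_iff₀ (hF.pos T), mul_comm, h.stepLaw_real_eq_integral]
    change F T * _ ≤ F t
    rw [hκint]
    -- Raising the level from `T₀` to `T` only shrinks the unnormalized restriction of the
    -- immigration law, so the estimate for `T₀` survives after multiplication by `F T`. For `t ≤ T`
    -- the tail of `κ T` is already `1`.
    calc _ ≤ ∫ x in s T₀, P.real {ω | thinning B x ω + Z 1 ω ∈ s t} ∂μ :=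
          setIntegral_mono_set (integrable_measureReal μ _).integrableOn
            (Eventually.of_forall fun x => measureReal_nonneg) (hanti hTT₀).eventuallyLE
      _ = F T₀ * (stepLaw P Z B (κ T₀)).real (s t) := by
          rw [← hκint, h.stepLaw_real_eq_integral]
      _ ≤ F T₀ * ((F T₀)⁻¹ * F t) := by
          refine mul_le_mul_of_nonneg_left ?_ hFT₀.le
          exact ((div_lt_iff₀ (hF.pos t)).1 (hT t htT)).le
      _ = F t := mul_inv_cancel_left₀ hFT₀.ne' _

lemma IsRCINARCoefficients.tendsto_iterate_tail (h : IsRCINARCoefficients P φ Z B)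
    {α : ℝ} (hα : 0 < α) (hρ : ∫ ω, φ 0 ω ^ α ∂P < 1)
    (hF : IsRegularTail α (fun t : ℝ => P.real {ω | t < (Z 0 ω : ℝ)}))
    (ν : Measure ℕ) [IsProbabilityMeasure ν] {c : ℝ}
    (hν : Tendsto (fun t : ℝ => ν.real {x : ℕ | t < (x : ℝ)} / P.real {ω | t < (Z 0 ω : ℝ)})
      atTop (𝓝 c)) (n : ℕ) :
    Tendsto (fun t : ℝ => ((stepLaw P Z B)^[n] ν).real {x : ℕ | t < (x : ℝ)} /
      P.real {ω | t < (Z 0 ω : ℝ)}) atTop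
      (𝓝 ((1 - ∫ ω, φ 0 ω ^ α ∂P)⁻¹ +
        (∫ ω, φ 0 ω ^ α ∂P) ^ n * (c - (1 - ∫ ω, φ 0 ω ^ α ∂P)⁻¹))) := by
  induction n with
  | zero => simpa using hν
  | succ n ih =>
    have := h.isProbabilityMeasure_iterate n ν
    simp only [Function.iterate_succ_apply']
    convert! h.tendsto_stepLaw_tail hα hF _ ih using 2
    have hne : 1 - ∫ ω, φ 0 ω ^ α ∂P ≠ 0 := (sub_pos.2 hρ).ne'
    field_simp
    ring

lemma IsRCINARCoefficients.tendsto_limit_tail (h : IsRCINARCoefficients P φ Z B)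
    {α : ℝ} (hα : 0 < α) (hρ : ∫ ω, φ 0 ω ^ α ∂P < 1)
    (hF : IsRegularTail α (fun t : ℝ => P.real {ω | t < (Z 0 ω : ℝ)}))
    {π : Measure ℕ} [IsProbabilityMeasure π]
    (hlim : ∀ (ν : Measure ℕ) [IsProbabilityMeasure ν] (s : Set ℕ),
      Tendsto (fun n => ((stepLaw P Z B)^[n] ν).real s) atTop (𝓝 (π.real s)))
    {κ : Measure ℕ} [IsProbabilityMeasure κ] (hκ : StochLE (stepLaw P Z B κ) κ) {c : ℝ}
    (hc : Tendsto (fun t : ℝ => κ.real {x : ℕ | t < (x : ℝ)} / P.real {ω | t < (Z 0 ω : ℝ)})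
        atTop (𝓝 c)) :
    Tendsto (fun t : ℝ => π.real {x : ℕ | t < (x : ℝ)} / P.real {ω | t < (Z 0 ω : ℝ)}) atTop
      (𝓝 (1 - ∫ ω, φ 0 ω ^ α ∂P)⁻¹) := by
  have hρ0 : 0 ≤ ∫ ω, φ 0 ω ^ α ∂P :=
    integral_nonneg fun ω => Real.rpow_nonneg (h.phi_mem 0 ω).1 α
  have hseq (c : ℝ) : Tendsto (fun n : ℕ => (1 - ∫ ω, φ 0 ω ^ α ∂P)⁻¹ +
      (∫ ω, φ 0 ω ^ α ∂P) ^ n * (c - (1 - ∫ ω, φ 0 ω ^ α ∂P)⁻¹)) atTop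
      (𝓝 (1 - ∫ ω, φ 0 ω ^ α ∂P)⁻¹) := by
    simpa using ((tendsto_pow_atTop_nhds_zero_of_lt_one hρ0 hρ).mul_const _).const_add
      (1 - ∫ ω, φ 0 ω ^ α ∂P)⁻¹
  have hd : Tendsto (fun t : ℝ => (Measure.dirac (0 : ℕ)).real {x : ℕ | t < (x : ℝ)} /
      P.real {ω | t < (Z 0 ω : ℝ)}) atTop (𝓝 0) := by
    refine tendsto_const_nhds.congr' ?_
    filter_upwards [eventually_ge_atTop 0] with t ht
    rw [measureReal_def, Measure.dirac_apply' _ MeasurableSet.of_discrete]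
    simp [not_lt.2 ht]
  have hd0 := h.isProbabilityMeasure_stepLaw (Measure.dirac 0)
  have hκ0 := h.isProbabilityMeasure_stepLaw κ
  have hdp := fun n => h.isProbabilityMeasure_iterate n (Measure.dirac 0)
  have hκp := fun n => h.isProbabilityMeasure_iterate n κ
  -- The number of steps `n` is the squeezing parameter: the iterates from `κ` bound `π` from above,
  -- those from `0` (tail constant `0`) from below.
  refine tendsto_of_parametric_bounds (l := atTop) (hseq c) (hseq 0)
    (Eventually.of_forall fun n => ⟨_, h.tendsto_iterate_tail hα hρ hF κ hc n,
      Eventually.of_forall fun t => div_le_div_of_nonneg_right ?_ (hF.pos t).le⟩)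
    (Eventually.of_forall fun n => ⟨_, h.tendsto_iterate_tail hα hρ hF _ hd n,
      Eventually.of_forall fun t => div_le_div_of_nonneg_right ?_ (hF.pos t).le⟩)
  · refine Antitone.le_of_tendsto (f := fun n =>
      ((stepLaw P Z B)^[n] κ).real {x : ℕ | t < (x : ℝ)}) ?_ (hlim _ _) n
    refine antitone_nat_of_succ_le fun n => StochLE.tail_le ?_ t
    rw [Function.iterate_succ_apply]
    exact h.stochLE_iterate n hκ
  · refine Monotone.ge_of_tendsto (f := fun n =>
      ((stepLaw P Z B)^[n] (Measure.dirac 0)).real {x : ℕ | t < (x : ℝ)}) ?_ (hlim _ _) n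
    refine monotone_nat_of_le_succ fun n => StochLE.tail_le ?_ t
    rw [Function.iterate_succ_apply]
    exact h.stochLE_iterate n (stochLE_dirac_zero _)

end

theorem theorem1 {Ω : Type*} [MeasurableSpace Ω] (P : Measure Ω) [IsProbabilityMeasure P]
    (φ : ℤ → Ω → ℝ) (Z : ℤ → Ω → ℕ) (B : ℤ → ℕ → Ω → ℕ)
    (hcoef : IsRCINARCoefficients P φ Z B)
    (hA1 : P {ω | φ 0 ω = 1} < 1)
    (α : ℝ) (hα : 0 < α) (h : ℝ → ℝ) (hreg : RegularlyVarying α h)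
    (hA2 : Tendsto (fun t : ℝ => h t * P.real {ω | t < (Z 0 ω : ℝ)}) atTop (𝓝 1)) :
    ∃ (π : Measure ℕ) (_ : IsProbabilityMeasure π),
      -- `π`, the law of `X_∞`, is the limit law of `X n` for every initial law
      (∀ (ν : Measure ℕ) [IsProbabilityMeasure ν],
        TendstoInDistribution (fun n : ℕ => rcinarRandom Z B n) atTop (fun x : ℕ => x)
          (fun _ => ν.prod P) π) ∧
      -- `π` is the one and only stationary law
      (∀ (ν : Measure ℕ) [IsProbabilityMeasure ν], IsStationaryLaw P Z B ν ↔ ν = π) ∧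
      -- the tail of `X_∞`
      0 < (1 - ∫ ω, φ 0 ω ^ α ∂P)⁻¹ ∧
      Tendsto (fun t : ℝ => h t * π.real {x : ℕ | t < (x : ℝ)}) atTop
        (𝓝 (1 - ∫ ω, φ 0 ω ^ α ∂P)⁻¹) := by
  have hρ := integral_rpow_lt_one (hcoef.measurable_phi 0) (hcoef.phi_mem 0) hA1 hα
  have hφ : ∫ ω, φ 0 ω ∂P < 1 := by
    simpa using integral_rpow_lt_one (hcoef.measurable_phi 0) (hcoef.phi_mem 0) hA1 one_pos
  have hF : IsRegularTail α (fun t : ℝ => P.real {ω | t < (Z 0 ω : ℝ)}) :=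
    hreg.isRegularTail (fun a b hab => measureReal_mono fun ω hω => lt_of_le_of_lt hab hω)
      (fun _ => measureReal_nonneg) (tendsto_tail_zero P (Z 0) (hcoef.measurable_Z 0)) hA2
  obtain ⟨κ, _, hκ, c, hc⟩ := hcoef.exists_stochLE_stepLaw hα hρ hF
  obtain ⟨π, hπ, hlim⟩ := hcoef.exists_limit hφ κ hκ
  refine ⟨π, hπ, fun ν _ => hcoef.tendstoInDistribution ν (hlim ν),
    fun ν _ => hcoef.isStationaryLaw_iff hlim ν, inv_pos.2 (sub_pos.2 hρ), ?_⟩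
  have := hA2.mul (hcoef.tendsto_limit_tail hα hρ hF hlim hκ hc)
  rw [one_mul] at this
  refine this.congr fun t => ?_
  rw [mul_assoc, mul_div_cancel₀ _ (hF.pos t).ne']
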